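/- **Setting.** Let $\mathcal A$ be a finite alphabet with $d\ge 2$ letters, $\pi=(\pi_t,\pi_b)$ irreducible combinatorial data (two bijections $\mathcal A\to\{1,\dots,d\}$ with $\pi_t^{-1}\{1,\dots,k\}\ne\pi_b^{-1}\{1,\dots,k\}$ for $1\le k<d$), and let $\tau\in\mathbb R^{\mathcal A}$ be a suspension vector: $\sum_{\pi_t(\alpha)<k}\tau_\alpha>0>\sum_{\pi_b(\alpha)<k}\tau_\alpha$ for $1<k\le d$. Let $R_t,R_b$ be the (invertible) Rauzy maps: with $\pi_t(\alpha_t)=\pi_b(\alpha_b)=d$, $R_t$ moves $\alpha_b$ in the bottom row to the place right after $\alpha_t$, and $R_b$ moves $\alpha_t$ in the top row to the place right after $\alpha_b$. The arrow $\pi\to R_t(\pi)$ (top type) has winner $\alpha_t$ and loser $\alpha_b$, the arrow $\pi\to R_b(\pi)$ (bottom type) has winner $\alpha_b$ and loser $\alpha_t$; an arrow $\gamma$ with winner $w$ and loser $\ell$ has the matrix $B_\gamma=\mathbb I+E_{\ell w}$. Starting from $(\pi^{(0)},\tau^{(0)})=(\pi,\tau)$ and any length vector $\lambda^{(0)}\in(0,\infty)^{\mathcal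 A}$, the backward Rauzy–Veech algorithm defines, as long as $\sum_\alpha\tau^{(n)}_\alpha\neq0$, the data at time $n-1\le -1$: $\pi^{(n-1)}=R_t^{-1}(\pi^{(n)})$ if $\sum_\alpha\tau_\alpha^{(n)}<0$ and $\pi^{(n-1)}=R_b^{-1}(\pi^{(n)})$ if $\sum_\alpha\tau_\alpha^{(n)}>0$; if $\gamma_n$ denotes the arrow $\pi^{(n-1)}\to\pi^{(n)}$ of the corresponding type, $w$ its winner and $\ell$ its loser, then $\tau^{(n-1)}_w=\tau^{(n)}_w+\tau^{(n)}_\ell$, $\lambda^{(n-1)}_w=\lambda^{(n)}_w+\lambda^{(n)}_\ell$, and the other components are unchanged. For $n'\le n\le 0$ put $B(n',n)=B_{\gamma_n}B_{\gamma_{n-1}}\cdots B_{\gamma_{n'+1}}$ and $B_\alpha(n',n)=\sum_\beta B(n',n)_{\alpha\beta}$; the norm $\|B\|$ of a matrix is the sum of the absolute values of its entries. Put $q^{(n)}=-\Omega_{\pi^{(n)}}\tau^{(n)}$, where $\Omega_{\alpha\beta}=+1$ if $\pi_t(\alpha)<\pi_t(\beta)$ and $\pi_b(\alpha)>\pi_b(\beta)$,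 $-1$ if $\pi_t(\alpha)>\pi_t(\beta)$ and $\pi_b(\alpha)<\pi_b(\beta)$, and $0$ otherwise. Let $L^{(n)}_\alpha=(0,q^{(n)}_\alpha)$ and $L^{(n)}=\bigsqcup_\alpha L^{(n)}_\alpha$. A finite path $\gamma_{n'+1}\star\cdots\star\gamma_n$ is complete if every letter is the winner of at least one of its arrows. The pair $(\pi,\tau)$ is of *dual Roth type* if the backward algorithm never stops, the backward path $\cdots\star\gamma_{-1}\star\gamma_0$ is a concatenation of infinitely many complete paths, and, with $\hat n_0=0$ and $\hat n_{k-1}$ the largest $n<\hat n_k$ such that $\gamma_{n+1}\star\cdots\star\gamma_{\hat n_k}$ is complete ($k\le 0$), (a) for every $\varepsilon>0$ there is $C_0>0$ with $\|B(\hat n_{k-1},\hat n_k)\|\le C_0\|B(\hat n_k,0)\|^{\varepsilon}$ for all $k\le0$; (b) there are $\theta>0$ and $C_1>0$ with $\|{}^tB_0(n,0)\|\le C_1\|{}^tB(n,0)\|^{1-\theta}$ for all $n\le0$, where ${}^tB_0(n,0)$ is the restriction of ${}^tB(n,0)$ to the hyperplane $\{v\in\mathbb R^{\mathcal A}:\sum_\alpha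 v_\alpha q^{(0)}_\alpha=0\}$, with its operator norm. Let $T^{(n)}$ be the interval exchange map with data $(\pi^{(n)},\lambda^{(n)})$ and exchanged intervals $I^{(n)}_\alpha$. For $n'\le n\le0$ and $0\le j<B_\alpha(n',n)$ let $\beta(\alpha,j)$ be the letter with $(T^{(n')})^j(I^{(n)}_\alpha)\subset I^{(n')}_{\beta(\alpha,j)}$. The dual special Birkhoff sum of a function $\psi$ on $L^{(n)}$ is the function on $L^{(n')}$ given, for $x\in L^{(n')}_\beta$, by $$S^\sharp(n,n')\psi(x)=\sum_{\alpha\in\mathcal A}\ \sum_{\substack{0\le j<B_\alpha(n',n)\\ \beta(\alpha,j)=\beta}}\psi\Big(x+\sum_{0\le i<j}q^{(n')}_{\beta(\alpha,i)}\Big),$$ where the argument of $\psi$ is taken in $L^{(n)}_\alpha$. **Proposition 4.5.** Assume that $(\pi,\tau)$ is of dual Roth type, and let $\theta>0$ be an exponent for which (b) holds. For every $\eta\in(0,1)$ there is a constant $C(\eta)>0$, depending only on $\pi,\tau,\theta,\eta$, such that for every length vector $\lambda\in(0,\infty)^{\mathcal A}$, every function $\psi$ on $L^{(0)}$ which is $\eta$-Hölder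 continuous on each $L^{(0)}_\alpha$ and has mean value $0$, $\sum_\alpha\int_{L^{(0)}_\alpha}\psi=0$, and every $n\le0$, $$\|S^\sharp(0,n)\psi\|_{C^0}\le C(\eta)\,\|\psi\|_{C^\eta}\,\|B(n,0)\|^{1-\frac{\theta\eta}{20}}.$$ Here $\|\cdot\|_{C^0}$ is the supremum over $L^{(n)}$, and $\|\psi\|_{C^\eta}$ is the supremum of $|\psi|$ over $L^{(0)}$ plus the largest of the $\eta$-Hölder seminorms of $\psi$ on the intervals $L^{(0)}_\alpha$. -/

import Mathlib

namespace DualRoth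

noncomputable section

open Matrix MeasureTheory Set
open scoped ENNReal NNReal

/-! ### Combinatorial data and the Rauzy maps

The alphabet is a finite type `A` with at least two letters, and `d = Fintype.card A`.
Positions are numbered `0, …, d - 1` (elements of `Fin d`) instead of `1, …, d`. -/

/-- Combinatorial data `π = (π_t, π_b)`: a pair of bijections from the alphabet onto positions. -/
@[ext]
structure CombData (A : Type*) [Fintype A] where
  top : A ≃ Fin (Fintype.card A)
  bot : A ≃ Fin (Fintype.card A)

/-- Irreducibility: `π_t⁻¹ {first k positions} ≠ π_b⁻¹ {first k positions}` for `1 ≤ k < d`. -/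
def CombData.Irreducible {A : Type*} [Fintype A] (p : CombData A) : Prop :=
  ∀ k : ℕ, 1 ≤ k → k < Fintype.card A →
    {a : A | (p.top a : ℕ) < k} ≠ {a : A | (p.bot a : ℕ) < k}

/-- The type of an arrow of a Rauzy diagram. -/
inductive ArrowType
  | top
  | bottom

/-- The permutation of positions which moves the last position to the place just after `k`,
shifts by one the positions strictly between, and fixes all positions up to `k`. -/
def slide {d : ℕ} (k : Fin d) : Equiv.Perm (Fin d) where
  toFun j := if h1 : j.1 ≤ k.1 then j else
    if h2 : j.1 + 1 < d then ⟨j.1 + 1, h2⟩ else ⟨k.1 + 1, by have := j.2; omega⟩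
  invFun i := if i.1 ≤ k.1 then i else
    if i.1 = k.1 + 1 then ⟨d - 1, by have := i.2; omega⟩ else ⟨i.1 - 1, by have := i.2; omega⟩
  left_inv j := by
    have := j.2
    have := k.2
    ext
    grind
  right_inv i := by
    have := i.2
    have := k.2
    ext
    grind

theorem slide_self {d : ℕ} (k : Fin d) : slide k k = k := by
  simp [slide]

section Rauzy

variable {A : Type*} [Fintype A] [Nontrivial A]

/-- The last position. -/
def lastPos (A : Type*) [Fintype A] [Nontrivial A] : Fin (Fintype.card A) :=
  ⟨Fintype.card A - 1, by have := Fintype.one_lt_card (α := A); omega⟩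

/-- The letter `α_t` in the last top position. -/
def CombData.lastTop (p : CombData A) : A := p.top.symm (lastPos A)

/-- The letter `α_b` in the last bottom position. -/
def CombData.lastBot (p : CombData A) : A := p.bot.symm (lastPos A)

/-- The Rauzy maps `R_t` and `R_b`, which are invertible.  `R_t` keeps the top row and moves the
last letter of the bottom row to the place just after `α_t` in that row; `R_b` is symmetric. -/
def rauzyMap : ArrowType → CombData A ≃ CombData A
  | .top =>
    { toFun := fun p => ⟨p.top, p.bot.trans (slide (p.bot p.lastTop))⟩
      invFun := fun p => ⟨p.top, p.bot.trans (slide (p.bot p.lastTop)).symm⟩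
      left_inv := fun p => by
        ext a
        · rfl
        · simp [CombData.lastTop, slide_self]
      right_inv := fun p => by
        have h : (slide (p.bot (p.top.symm (lastPos A)))).symm (p.bot (p.top.symm (lastPos A)))
            = p.bot (p.top.symm (lastPos A)) := by
          rw [Equiv.symm_apply_eq, slide_self]
        ext a
        · rfl
        · simp [CombData.lastTop, h] }
  | .bottom =>
    { toFun := fun p => ⟨p.top.trans (slide (p.top p.lastBot)), p.bot⟩
      invFun := fun p => ⟨p.top.trans (slide (p.top p.lastBot)).symm, p.bot⟩
      left_inv := fun p => by
        ext a
        · simp [CombData.lastBot, slide_self]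
        · rfl
      right_inv := fun p => by
        have h : (slide (p.top (p.bot.symm (lastPos A)))).symm (p.top (p.bot.symm (lastPos A)))
            = p.top (p.bot.symm (lastPos A)) := by
          rw [Equiv.symm_apply_eq, slide_self]
        ext a
        · simp [CombData.lastBot, h]
        · rfl }

/-- The winner of the arrow of the given type which starts at `p`. -/
def winner : ArrowType → CombData A → A
  | .top, p => p.lastTop
  | .bottom, p => p.lastBot

/-- The loser of the arrow of the given type which starts at `p`. -/
def loser : ArrowType → CombData A → A
  | .top, p => p.lastBot
  | .bottom, p => p.lastTop

/-- The matrix `B_γ = 1 + E_{loser, winner}` of the arrow of the given type starting at `p`. -/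
def arrowMatrix [DecidableEq A] (ty : ArrowType) (p : CombData A) : Matrix A A ℕ :=
  1 + Matrix.single (loser ty p) (winner ty p) 1

end Rauzy

/-! ### Suspension data, the matrix `Ω_π`, interval exchange maps -/

section Iem

variable {A : Type*} [Fintype A]

/-- `τ ∈ Θ_π`: the sums of `τ` over the first `k` top (bottom) positions are positive (negative),
for `1 ≤ k < d`. -/
def IsSuspension (p : CombData A) (τ : A → ℝ) : Prop :=
  ∀ k : ℕ, 1 ≤ k → k < Fintype.card A →
    0 < ∑ a with (p.top a : ℕ) < k, τ a ∧ ∑ a with (p.bot a : ℕ) < k, τ a < 0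

/-- The antisymmetric matrix `Ω_π`. -/
def omegaMatrix (p : CombData A) : Matrix A A ℝ := fun a b =>
  if p.top a < p.top b ∧ p.bot b < p.bot a then 1
  else if p.top b < p.top a ∧ p.bot a < p.bot b then -1 else 0

/-- The vector of heights `q = -Ω_π τ`. -/
def heights (p : CombData A) (τ : A → ℝ) : A → ℝ := -(omegaMatrix p *ᵥ τ)

/-- The translation vector `δ = Ω_π l` of the interval exchange map with data `(p, l)`. -/
def translation (p : CombData A) (l : A → ℝ) : A → ℝ := omegaMatrix p *ᵥ l

/-- Left endpoint of the top interval with label `a`. -/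
def leftEnd (p : CombData A) (l : A → ℝ) (a : A) : ℝ := ∑ b with p.top b < p.top a, l b

/-- Right endpoint of the top interval with label `a`. -/
def rightEnd (p : CombData A) (l : A → ℝ) (a : A) : ℝ := ∑ b with p.top b ≤ p.top a, l b

/-- The open exchanged interval `I_a = I_a^t`. -/
def topInterval (p : CombData A) (l : A → ℝ) (a : A) : Set ℝ :=
  Ioo (leftEnd p l a) (rightEnd p l a)

/-- The interval exchange map `T_{p,l}`, extended by right-continuity to the left endpoints of the
exchanged intervals (and by the identity outside of its domain `[0, ∑ l)`). -/
def iem (p : CombData A) (l : A → ℝ) (x : ℝ) : ℝ :=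
  x + ∑ a, (Ico (leftEnd p l a) (rightEnd p l a)).indicator (fun _ => translation p l a) x

end Iem

/-! ### Backward Rauzy–Veech induction

All times are nonpositive; the natural number `n` stands for the time `-n`. -/

section Backward

variable {A : Type*} [Fintype A] [DecidableEq A] [Nontrivial A]

/-- The type of the arrow which ends at `(p, τ)`: top if `∑ τ < 0`, bottom if `∑ τ > 0`.
If `∑ τ = 0` the backward algorithm stops; this is excluded in `HasBackwardPath`. -/
def backType (τ : A → ℝ) : ArrowType := if ∑ a, τ a < 0 then .top else .bottom

/-- The backward move on a vector in `ℝ^A` (lengths or suspension data): the loser's component is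
added to that of the winner. Here `p` is the origin of the arrow. -/
def backVec (ty : ArrowType) (p : CombData A) (v : A → ℝ) : A → ℝ :=
  Function.update v (winner ty p) (v (winner ty p) + v (loser ty p))

/-- `(π^(-n), τ^(-n))`, for the backward algorithm started at `(π, τ)`. -/
def backData (p : CombData A) (τ : A → ℝ) : ℕ → CombData A × (A → ℝ)
  | 0 => (p, τ)
  | n + 1 =>
    let s := backData p τ n
    let ty := backType s.2
    let p1 := (rauzyMap ty).symm s.1
    (p1, backVec ty p1 s.2)

/-- `π^(-n)`. -/
def piAt (p : CombData A) (τ : A → ℝ) (n : ℕ) : CombData A := (backData p τ n).1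

/-- `τ^(-n)`. -/
def tauAt (p : CombData A) (τ : A → ℝ) (n : ℕ) : A → ℝ := (backData p τ n).2

/-- The type of the arrow `γ_{-n}`, which goes from `π^(-n-1)` to `π^(-n)`. -/
def typeAt (p : CombData A) (τ : A → ℝ) (n : ℕ) : ArrowType := backType (tauAt p τ n)

/-- The winner of the arrow `γ_{-n}`. -/
def winnerAt (p : CombData A) (τ : A → ℝ) (n : ℕ) : A :=
  winner (typeAt p τ n) (piAt p τ (n + 1))

/-- `l^(-n)`, the length data at time `-n`, for the initial length data `l`. -/
def lenAt (p : CombData A) (τ l : A → ℝ) : ℕ → A → ℝ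
  | 0 => l
  | n + 1 => backVec (typeAt p τ n) (piAt p τ (n + 1)) (lenAt p τ l n)

/-- `q^(-n) = -Ω_{π^(-n)} τ^(-n)`. -/
def qAt (p : CombData A) (τ : A → ℝ) (n : ℕ) : A → ℝ := heights (piAt p τ n) (tauAt p τ n)

/-- The matrix `B(-n, -m) = B_{γ_{-m}} B_{γ_{-m-1}} ⋯ B_{γ_{-n+1}}`, for `m ≤ n`. -/
def kz (p : CombData A) (τ : A → ℝ) (n m : ℕ) : Matrix A A ℕ :=
  ((List.range' m (n - m)).map fun j => arrowMatrix (typeAt p τ j) (piAt p τ (j + 1))).prod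

/-- The norm of a matrix with nonnegative integer entries: the sum of its entries. -/
def matNorm (B : Matrix A A ℕ) : ℝ := ∑ a, ∑ b, (B a b : ℝ)

/-- The finite path `γ(-n, -m)` is complete: each letter is the winner of one of its arrows. -/
def CompletePath (p : CombData A) (τ : A → ℝ) (n m : ℕ) : Prop :=
  ∀ a : A, ∃ j : ℕ, m ≤ j ∧ j < n ∧ winnerAt p τ j = a

/-- The backward algorithm never stops, so that `(π, τ)` has a backward rotation number. -/
def HasBackwardPath (p : CombData A) (τ : A → ℝ) : Prop :=
  ∀ n : ℕ, ∑ a, tauAt p τ n a ≠ 0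

/-- The backward path is `∞`-complete: a concatenation of infinitely many complete paths. -/
def InfinitelyComplete (p : CombData A) (τ : A → ℝ) : Prop :=
  ∃ s : ℕ → ℕ, StrictMono s ∧ s 0 = 0 ∧ ∀ k, CompletePath p τ (s (k + 1)) (s k)

/-- The accelerated times (with the sign reversed): `accTime k` stands for the time
`n̂_{-k} = -accTime k`, where `n̂_0 = 0` and `n̂_{-k-1}` is the largest `n < n̂_{-k}` such that
`γ(n, n̂_{-k})` is complete. -/
def accTime (p : CombData A) (τ : A → ℝ) : ℕ → ℕ
  | 0 => 0
  | k + 1 => sInf {n : ℕ | accTime p τ k < n ∧ CompletePath p τ n (accTime p τ k)}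

/-! ### Dual Roth type -/

/-- Condition (a), growth of the dual matrices. -/
def DualMatrixGrowth (p : CombData A) (τ : A → ℝ) : Prop :=
  ∀ ε : ℝ, 0 < ε → ∃ C₀ : ℝ, 0 < C₀ ∧ ∀ k : ℕ,
    matNorm (kz p τ (accTime p τ (k + 1)) (accTime p τ k))
      ≤ C₀ * matNorm (kz p τ (accTime p τ k) 0) ^ ε

/-- The hyperplane `Γ₀^♯(-n)` of the vectors (functions which are constant on each `L_a^(-n)`)
with zero mean value: `∑ v_a q_a^(-n) = 0`. -/
def gammaZero (p : CombData A) (τ : A → ℝ) (n : ℕ) : Submodule ℝ (A → ℝ) where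
  carrier := {v | ∑ a, v a * qAt p τ n a = 0}
  zero_mem' := by simp
  add_mem' {u v} hu hv := by
    simp only [mem_ofPred_eq, Pi.add_apply, add_mul, Finset.sum_add_distrib] at *
    rw [hu, hv, add_zero]
  smul_mem' c v hv := by
    simp only [mem_ofPred_eq, Pi.smul_apply, smul_eq_mul, mul_assoc, ← Finset.mul_sum] at *
    rw [hv, mul_zero]

/-- `ᵗB₀(-n, -m)`: the restriction of `ᵗB(-n, -m)` to the hyperplane `Γ₀^♯(-m)`. -/
def transposeRestrict (p : CombData A) (τ : A → ℝ) (n m : ℕ) :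
    gammaZero p τ m →L[ℝ] (A → ℝ) :=
  LinearMap.toContinuousLinearMap
    ((((kz p τ n m).map (Nat.cast : ℕ → ℝ))ᵀ.mulVecLin).domRestrict (gammaZero p τ m))

/-- Condition (b), the dual spectral gap, with exponent `θ`. The norm on the left is the operator
norm for the sup norm of `ℝ^A`. -/
def DualSpectralGap (p : CombData A) (τ : A → ℝ) (θ : ℝ) : Prop :=
  0 < θ ∧ ∃ C₁ : ℝ, 0 < C₁ ∧ ∀ n : ℕ,
    ‖transposeRestrict p τ n 0‖ ≤ C₁ * matNorm (kz p τ n 0)ᵀ ^ (1 - θ)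

/-- `(π, τ)` is of (weak) dual Roth type. -/
structure IsDualRothType (p : CombData A) (τ : A → ℝ) : Prop where
  irreducible : p.Irreducible
  suspension : IsSuspension p τ
  hasPath : HasBackwardPath p τ
  complete : InfinitelyComplete p τ
  growth : DualMatrixGrowth p τ
  gap : ∃ θ : ℝ, DualSpectralGap p τ θ

/-! ### Dual special Birkhoff sums

A function on `L^(-n)`, the disjoint union of the intervals `L_a^(-n) = (0, q_a^(-n))`, is a family
`ψ : A → ℝ → ℝ`, of which only the values `ψ a x` with `x ∈ L_a^(-n)` matter. -/

/-- The interval `L_a^(-n) = (0, q_a^(-n))`. -/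
def vertInterval (p : CombData A) (τ : A → ℝ) (n : ℕ) (a : A) : Set ℝ := Ioo 0 (qAt p τ n a)

/-- The interval exchange map `T^(-n)`. -/
def iemAt (p : CombData A) (τ l : A → ℝ) (n : ℕ) : ℝ → ℝ := iem (piAt p τ n) (lenAt p τ l n)

/-- The interval `I_a^(-n)`. -/
def intervalAt (p : CombData A) (τ l : A → ℝ) (n : ℕ) (a : A) : Set ℝ :=
  topInterval (piAt p τ n) (lenAt p τ l n) a

/-- `B_a(-n, -m) = ∑_b B(-n, -m)_{a b}`. -/
def rowSum (p : CombData A) (τ : A → ℝ) (n m : ℕ) (a : A) : ℕ := ∑ b, kz p τ n m a b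

/-- The letter `β(a, j)` such that `(T^(-n))^j (I_a^(-m)) ⊆ I_{β(a,j)}^(-n)`, for `m ≤ n` and
`0 ≤ j < B_a(-n, -m)`. -/
def visit (p : CombData A) (τ l : A → ℝ) (n m : ℕ) (a : A) (j : ℕ) : A :=
  Classical.epsilon fun b =>
    (iemAt p τ l n)^[j] '' intervalAt p τ l m a ⊆ intervalAt p τ l n b

/-- `Sq(j) = ∑_{i < j} q_{β(a,i)}^(-n)`. -/
def shift (p : CombData A) (τ l : A → ℝ) (n m : ℕ) (a : A) (j : ℕ) : ℝ :=
  ∑ i ∈ Finset.range j, qAt p τ n (visit p τ l n m a i)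

/-- The dual special Birkhoff sum `S^♯(-m, -n) ψ`, for `m ≤ n`: a function on `L^(-m)` is sent to
a function on `L^(-n)`. -/
def dualBirkhoff (p : CombData A) (τ l : A → ℝ) (m n : ℕ) (ψ : A → ℝ → ℝ) : A → ℝ → ℝ :=
  fun b x => ∑ a, ∑ j ∈ Finset.range (rowSum p τ n m a) with visit p τ l n m a j = b,
    ψ a (x + shift p τ l n m a j)

/-- The `C⁰` norm of a function on `L^(-n)`, as an extended nonnegative real. -/
def normC0 (p : CombData A) (τ : A → ℝ) (n : ℕ) (ψ : A → ℝ → ℝ) : ℝ≥0∞ :=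
  ⨆ a, ⨆ x ∈ vertInterval p τ n a, ‖ψ a x‖ₑ

/-- `ψ` is Hölder continuous with exponent `η` on each of the intervals of `L^(-n)`. -/
def IsHolder (p : CombData A) (τ : A → ℝ) (n : ℕ) (η : ℝ≥0) (ψ : A → ℝ → ℝ) : Prop :=
  ∀ a, MemHolder η ((vertInterval p τ n a).domRestrict (ψ a))

/-- The `C^η` norm of a function on `L^(-n)`: the `C⁰` norm plus the largest of the Hölder
seminorms on the intervals `L_a^(-n)`. -/
def normHolder (p : CombData A) (τ : A → ℝ) (n : ℕ) (η : ℝ≥0) (ψ : A → ℝ → ℝ) : ℝ≥0∞ :=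
  normC0 p τ n ψ + ⨆ a, eHolderNorm η ((vertInterval p τ n a).domRestrict (ψ a))

/-- `ψ` has mean value zero on `L^(-n)`. -/
def MeanZero (p : CombData A) (τ : A → ℝ) (n : ℕ) (ψ : A → ℝ → ℝ) : Prop :=
  ∑ a, ∫ x in vertInterval p τ n a, ψ a x = 0

end Backward

end

end DualRoth

/-! Write Y = ‖B(n,0)‖. The sum S♯(0,n) is a composition of elementary steps, one for each arrow:
the vertical interval of the loser is cut into one piece for the loser and one for the winner, and
the second piece is added to the function carried by the winner. These steps do not involve the
lengths λ (`dualBirkhoff_eq_iterSum`), which makes the constant uniform in λ. On functions constant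
on each interval they act by ᵗB, they transport pointwise bounds and moduli of continuity by ᵗB, and
they preserve the total integral.

Stop at an accelerated time m at which X = ‖B(m,0)‖ is about Y^(θ/10), up to a power 3/2 coming from
condition (a) (`exists_accTime_between`). Since 2d consecutive complete paths give a positive
matrix, condition (a) makes the columns of B(m,0) almost balanced (`accNorm_le_colSum`). Hence the
intervals at time m have length at most about 1/X, and ‖B(n,m)‖ is at most about Y/X, up to small
powers of X. Split S♯(0,m)ψ into its mean values u on the intervals and an oscillating rest
(`exists_mean_decomposition`). The Hölder condition bounds the rest by X^(1-η), and the remaining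
steps bring it to Y·X^(-η) up to small powers, which is the saving Y^(-θη/20).

The vector u has zero mean and norm at most a multiple of X. The relation Ω_0 = B Ω_m ᵗB gives u =
ᵗB(m,0)v + r with v of zero mean, Ω_m r = 0, and v and r bounded by X‖u‖ and X²‖u‖ up to constants
(`exists_bounded_lift`). The spectral gap (b) controls ᵗB(n,0)v by Y^(1-θ)X². On the kernel of Ω the
matrices ᵗB are uniformly bounded (`norm_iterVec_kernel_le`), so r contributes X³. This last term is
harmless because θ ≤ 2 (`DualSpectralGap.le_two`). -/

namespace DualRoth

open Matrix MeasureTheory Set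
open scoped ENNReal NNReal

noncomputable section

/-! ### Partial sums along the rows, and the effect of moving the last letter -/

section Rows

variable {A : Type*} [Fintype A]

/-- The sum of `v` over the letters which precede `a` in the row `e`. -/
def leftSum (e : A ≃ Fin (Fintype.card A)) (v : A → ℝ) (a : A) : ℝ := ∑ b with e b < e a, v b

theorem leftSum_eq_sum_ite (e : A ≃ Fin (Fintype.card A)) (v : A → ℝ) (a : A) :
    leftSum e v a = ∑ b, if e b < e a then v b else 0 := Finset.sum_filter _ _

theorem leftSum_add_le {e : A ≃ Fin (Fintype.card A)} {v : A → ℝ} (hv : ∀ a, 0 < v a) {a b : A}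
    (h : e a < e b) : leftSum e v a + v a ≤ leftSum e v b := by
  classical
  have h1 : leftSum e v a + v a = ∑ c ∈ insert a (Finset.univ.filter fun c => e c < e a), v c := by
    rw [Finset.sum_insert (by simp), leftSum, add_comm]
  rw [h1]
  refine Finset.sum_le_sum_of_subset_of_nonneg ?_ fun c _ _ => (hv c).le
  intro c hc
  simp only [Finset.mem_insert, Finset.mem_filter, Finset.mem_univ, true_and] at hc ⊢
  rcases hc with rfl | hc
  · exact h
  · exact hc.trans h

theorem omegaMatrix_mulVec (p : CombData A) (v : A → ℝ) (a : A) :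
    (omegaMatrix p *ᵥ v) a = leftSum p.bot v a - leftSum p.top v a := by
  simp only [mulVec, dotProduct, leftSum, Finset.sum_filter, ← Finset.sum_sub_distrib]
  refine Finset.sum_congr rfl fun b _ => ?_
  rcases eq_or_ne a b with rfl | h
  · simp [omegaMatrix]
  · have h1 := p.top.injective.ne h
    have h2 := p.bot.injective.ne h
    unfold omegaMatrix
    rcases lt_or_gt_of_ne h1 with h1 | h1 <;> rcases lt_or_gt_of_ne h2 with h2 | h2 <;>
      simp [h1, h2, h1.not_gt, h2.not_gt]

theorem heights_apply (p : CombData A) (v : A → ℝ) (a : A) :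
    heights p v a = leftSum p.top v a - leftSum p.bot v a := by
  simp [heights, omegaMatrix_mulVec]

theorem translation_apply (p : CombData A) (v : A → ℝ) (a : A) :
    translation p v a = leftSum p.bot v a - leftSum p.top v a :=
  omegaMatrix_mulVec p v a

theorem leftEnd_eq (p : CombData A) (v : A → ℝ) (a : A) : leftEnd p v a = leftSum p.top v a := rfl

theorem rightEnd_eq (p : CombData A) (v : A → ℝ) (a : A) :
    rightEnd p v a = leftSum p.top v a + v a := by
  classical
  have : (Finset.univ.filter fun b => p.top b ≤ p.top a)
      = insert a (Finset.univ.filter fun b => p.top b < p.top a) := by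
    ext b
    simp [le_iff_lt_or_eq, or_comm]
  rw [rightEnd, this, Finset.sum_insert (by simp), leftSum, add_comm]

variable [Nontrivial A]

theorem le_lastPos (i : Fin (Fintype.card A)) : i ≤ lastPos A := by
  have := i.2
  simp only [lastPos, Fin.le_def]
  omega

theorem leftSum_last {e : A ≃ Fin (Fintype.card A)} {a : A} (h : e a = lastPos A) (v : A → ℝ) :
    leftSum e v a + v a = ∑ b, v b := by
  classical
  have : (Finset.univ : Finset A) = insert a (Finset.univ.filter fun b => e b < e a) := by
    ext b
    have := le_lastPos (e b)
    rw [← h] at this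
    simp only [Finset.mem_univ, Finset.mem_insert, Finset.mem_filter, true_and, true_iff]
    rcases this.eq_or_lt with h | h
    · exact Or.inl (e.injective h)
    · exact Or.inr h
  rw [this, Finset.sum_insert (by simp), leftSum, add_comm]

theorem leftSum_update_last [DecidableEq A] {e : A ≃ Fin (Fintype.card A)} {w : A}
    (h : e w = lastPos A) (v : A → ℝ) (x : ℝ) (a : A) :
    leftSum e (Function.update v w x) a = leftSum e v a := by
  refine Finset.sum_congr rfl fun b hb => ?_
  rw [Function.update_of_ne]
  rintro rfl
  simp only [Finset.mem_filter, Finset.mem_univ, true_and, h] at hb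
  exact (le_lastPos _).not_gt hb

theorem slide_lt_of_ne {d : ℕ} {k i j : Fin d} (hi : i.1 ≠ d - 1) (hj : j.1 ≠ d - 1) :
    slide k i < slide k j ↔ i < j := by
  have := i.2
  have := j.2
  simp only [slide, Equiv.coe_fn_mk, Fin.lt_def]
  grind

theorem slide_last_lt {d : ℕ} {k i j : Fin d} (hk : k.1 ≠ d - 1) (hi : i.1 = d - 1)
    (hj : j.1 ≠ d - 1) : slide k i < slide k j ↔ k < j := by
  have := i.2
  have := j.2
  have := k.2
  simp only [slide, Equiv.coe_fn_mk, Fin.lt_def]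
  grind

theorem slide_lt_last {d : ℕ} {k i j : Fin d} (hk : k.1 ≠ d - 1) (hi : i.1 ≠ d - 1)
    (hj : j.1 = d - 1) : slide k i < slide k j ↔ i ≤ k := by
  have := i.2
  have := j.2
  have := k.2
  simp only [slide, Equiv.coe_fn_mk, Fin.lt_def, Fin.le_def]
  grind

theorem row_ne_last {e : A ≃ Fin (Fintype.card A)} {a l : A} (hl : e l = lastPos A)
    (h : a ≠ l) : (e a).1 ≠ Fintype.card A - 1 := by
  intro h'
  exact h (e.injective (by rw [hl]; exact Fin.ext h'))

/-- In the new row `l` stands immediately after `w`, so for any other letter the two are counted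
together or not at all. This amounts to leaving `l` at the end of the old row and giving `w` the
joint weight. -/
theorem leftSum_slide_of_ne [DecidableEq A] {e : A ≃ Fin (Fintype.card A)} {w l : A}
    (hl : e l = lastPos A) (hwl : w ≠ l) (v : A → ℝ) {a : A} (ha : a ≠ l) :
    leftSum (e.trans (slide (e w))) v a
      = leftSum e (Function.update v w (v w + v l)) a := by
  have hw' := row_ne_last hl hwl
  have ha' := row_ne_last hl ha
  have hl' : (e l).1 = Fintype.card A - 1 := by rw [hl]; rfl
  have key : ∀ b, (if e.trans (slide (e w)) b < e.trans (slide (e w)) a then v b else 0)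
      = (if e b < e a then v b else 0) + if b = l then (if e w < e a then v l else 0) else 0 := by
    intro b
    simp only [Equiv.trans_apply]
    rcases eq_or_ne b l with rfl | hb
    · have : ¬ e b < e a := by rw [hl]; exact (le_lastPos _).not_gt
      simp [slide_last_lt hw' hl' ha', this]
    · simp [slide_lt_of_ne (k := e w) (row_ne_last hl hb) ha', hb]
  have key2 : ∀ b, (if e b < e a then Function.update v w (v w + v l) b else 0)
      = (if e b < e a then v b else 0) + if b = w then (if e w < e a then v l else 0) else 0 := by
    intro b
    rcases eq_or_ne b w with rfl | hb
    · by_cases h : e b < e a <;> simp [h]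
    · simp [hb]
  simp only [leftSum_eq_sum_ite, key, key2, Finset.sum_add_distrib]
  simp

theorem leftSum_slide_self {e : A ≃ Fin (Fintype.card A)} {w l : A}
    (hl : e l = lastPos A) (hwl : w ≠ l) (v : A → ℝ) :
    leftSum (e.trans (slide (e w))) v l = leftSum e v w + v w := by
  classical
  have hw' := row_ne_last hl hwl
  have hl' : (e l).1 = Fintype.card A - 1 := by rw [hl]; rfl
  have key : ∀ b, (if e.trans (slide (e w)) b < e.trans (slide (e w)) l then v b else 0)
      = (if e b < e w then v b else 0) + if b = w then v w else 0 := by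
    intro b
    simp only [Equiv.trans_apply]
    rcases eq_or_ne b l with rfl | hb
    · have : ¬ e b < e w := by rw [hl]; exact (le_lastPos _).not_gt
      simp [this, hwl.symm]
    · rcases eq_or_ne b w with rfl | hbw
      · simp [slide_lt_last hw' hw' hl']
      · have := e.injective.ne hbw
        simp [slide_lt_last hw' (row_ne_last hl hb) hl', hbw, this.le_iff_lt]
  simp only [leftSum_eq_sum_ite, key, Finset.sum_add_distrib]
  simp

end Rows

/-! ### One backward Rauzy step: suspension data and the relation between the matrices Ω -/

section Step

variable {A : Type*} [Fintype A]

/-- The row which is not changed by the Rauzy map of the given type. -/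
def CombData.fixedRow (p : CombData A) : ArrowType → (A ≃ Fin (Fintype.card A))
  | .top => p.top
  | .bottom => p.bot

/-- The row which is changed by the Rauzy map of the given type. -/
def CombData.movedRow (p : CombData A) : ArrowType → (A ≃ Fin (Fintype.card A))
  | .top => p.bot
  | .bottom => p.top

theorem exists_of_lt_card (e : A ≃ Fin (Fintype.card A)) {k : ℕ} (hk : k < Fintype.card A) :
    ∃ a, (e a : ℕ) = k := ⟨e.symm ⟨k, hk⟩, by simp⟩

theorem isSuspension_iff (p : CombData A) (τ : A → ℝ) :
    IsSuspension p τ ↔ (∀ a, (p.top a : ℕ) ≠ 0 → 0 < leftSum p.top τ a) ∧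
      ∀ a, (p.bot a : ℕ) ≠ 0 → leftSum p.bot τ a < 0 := by
  constructor
  · intro h
    exact ⟨fun a ha => (h _ (Nat.one_le_iff_ne_zero.2 ha) (p.top a).2).1,
      fun a ha => (h _ (Nat.one_le_iff_ne_zero.2 ha) (p.bot a).2).2⟩
  · rintro ⟨h1, h2⟩ k hk hk'
    obtain ⟨a, ha⟩ := exists_of_lt_card p.top hk'
    obtain ⟨b, hb⟩ := exists_of_lt_card p.bot hk'
    constructor
    · have := h1 a (by omega)
      simpa only [leftSum, Fin.lt_def, ha] using this
    · have := h2 b (by omega)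
      simpa only [leftSum, Fin.lt_def, hb] using this

variable [Nontrivial A]

theorem heights_pos {p : CombData A} {τ : A → ℝ} (h : IsSuspension p τ) (a : A) :
    0 < heights p τ a := by
  have hd := Fintype.one_lt_card (α := A)
  obtain ⟨h1, h2⟩ := (isSuspension_iff p τ).1 h
  rw [heights_apply]
  have z1 : (p.top a : ℕ) = 0 → leftSum p.top τ a = 0 := fun h0 => by
    simp [leftSum, Fin.lt_def, h0]
  have z2 : (p.bot a : ℕ) = 0 → leftSum p.bot τ a = 0 := fun h0 => by
    simp [leftSum, Fin.lt_def, h0]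
  by_cases ht : (p.top a : ℕ) = 0 <;> by_cases hb : (p.bot a : ℕ) = 0
  -- If `a` came first in both rows, the conditions for one letter would make `τ a` both positive
  -- and negative.
  · exfalso
    have h3 := h 1 le_rfl hd
    have e1 : (Finset.univ.filter fun b => (p.top b : ℕ) < 1) = {a} := by
      ext b
      simp only [Finset.mem_filter, Finset.mem_univ, true_and, Finset.mem_singleton,
        Nat.lt_one_iff]
      exact ⟨fun hb => p.top.injective (Fin.ext (hb.trans ht.symm)), fun hb => hb ▸ ht⟩
    have e2 : (Finset.univ.filter fun b => (p.bot b : ℕ) < 1) = {a} := by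
      ext b
      simp only [Finset.mem_filter, Finset.mem_univ, true_and, Finset.mem_singleton,
        Nat.lt_one_iff]
      exact ⟨fun hb' => p.bot.injective (Fin.ext (hb'.trans hb.symm)), fun hb' => hb' ▸ hb⟩
    rw [e1, e2] at h3
    linarith
  · linarith [z1 ht, h2 a hb]
  · linarith [z2 hb, h1 a ht]
  · linarith [h1 a ht, h2 a hb]

theorem fixedRow_rauzyMap (ty : ArrowType) (p : CombData A) :
    (rauzyMap ty p).fixedRow ty = p.fixedRow ty := by
  cases ty <;> rfl

theorem movedRow_rauzyMap (ty : ArrowType) (p : CombData A) :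
    (rauzyMap ty p).movedRow ty
      = (p.movedRow ty).trans (slide (p.movedRow ty (winner ty p))) := by
  cases ty <;> rfl

theorem fixedRow_winner (ty : ArrowType) (p : CombData A) :
    p.fixedRow ty (winner ty p) = lastPos A := by
  cases ty <;> exact Equiv.apply_symm_apply _ _

theorem movedRow_loser (ty : ArrowType) (p : CombData A) :
    p.movedRow ty (loser ty p) = lastPos A := by
  cases ty <;> exact Equiv.apply_symm_apply _ _

/-- A letter which is both winner and loser is last in both rows. The two partial sums before it are
then equal, whereas suspension data give them opposite signs. -/
theorem winner_ne_loser {ty : ArrowType} {p : CombData A} {τ : A → ℝ}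
    (h : IsSuspension (rauzyMap ty p) τ) : winner ty p ≠ loser ty p := by
  intro he
  have hd := Fintype.one_lt_card (α := A)
  obtain ⟨h1, h2⟩ := (isSuspension_iff _ τ).1 h
  have hf : (rauzyMap ty p).fixedRow ty (winner ty p) = lastPos A := by
    rw [fixedRow_rauzyMap, fixedRow_winner]
  have hm : (rauzyMap ty p).movedRow ty (winner ty p) = lastPos A := by
    rw [movedRow_rauzyMap, he, Equiv.trans_apply, movedRow_loser, slide_self]
  have ht : (rauzyMap ty p).top (winner ty p) = lastPos A := by
    cases ty
    · exact hf
    · exact hm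
  have hb : (rauzyMap ty p).bot (winner ty p) = lastPos A := by
    cases ty
    · exact hm
    · exact hf
  have h0 : (lastPos A : ℕ) ≠ 0 := by
    simp only [lastPos]
    omega
  have := h1 _ (by rw [ht]; exact h0)
  have := h2 _ (by rw [hb]; exact h0)
  linarith [leftSum_last ht τ, leftSum_last hb τ]

variable [DecidableEq A]

theorem sum_backVec (ty : ArrowType) (p : CombData A) (v : A → ℝ) :
    ∑ a, backVec ty p v a = ∑ a, v a + v (loser ty p) := by
  have : ∀ a, backVec ty p v a = v a + if a = winner ty p then v (loser ty p) else 0 := by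
    intro a
    rcases eq_or_ne a (winner ty p) with rfl | h
    · simp [backVec]
    · simp [backVec, h]
  simp [this, Finset.sum_add_distrib]

theorem backVec_of_ne {ty : ArrowType} {p : CombData A} {a : A} (h : a ≠ winner ty p)
    (v : A → ℝ) : backVec ty p v a = v a := by
  simp [backVec, h]

theorem backVec_winner (ty : ArrowType) (p : CombData A) (v : A → ℝ) :
    backVec ty p v (winner ty p) = v (winner ty p) + v (loser ty p) := by
  simp [backVec]

theorem leftSum_fixedRow (ty : ArrowType) (p : CombData A) (v : A → ℝ) (a : A) :
    leftSum (p.fixedRow ty) (backVec ty p v) a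
      = leftSum ((rauzyMap ty p).fixedRow ty) v a := by
  rw [fixedRow_rauzyMap]
  exact leftSum_update_last (fixedRow_winner ty p) _ _ _

theorem leftSum_movedRow_of_ne {ty : ArrowType} {p : CombData A}
    (h : winner ty p ≠ loser ty p) (v : A → ℝ) {a : A} (ha : a ≠ loser ty p) :
    leftSum (p.movedRow ty) (backVec ty p v) a
      = leftSum ((rauzyMap ty p).movedRow ty) v a := by
  rw [movedRow_rauzyMap, leftSum_slide_of_ne (movedRow_loser ty p) h v ha]
  rfl

theorem leftSum_movedRow_loser {ty : ArrowType} {p : CombData A}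
    (h : winner ty p ≠ loser ty p) (v : A → ℝ) :
    leftSum (p.movedRow ty) (backVec ty p v) (loser ty p) = ∑ a, v a := by
  have := leftSum_last (movedRow_loser ty p) (backVec ty p v)
  rw [sum_backVec, backVec_of_ne h.symm] at this
  linarith

theorem leftSum_movedRow_rauzyMap_loser {ty : ArrowType} {p : CombData A}
    (h : winner ty p ≠ loser ty p) (v : A → ℝ) :
    leftSum ((rauzyMap ty p).movedRow ty) v (loser ty p)
      = leftSum (p.movedRow ty) (backVec ty p v) (winner ty p) + v (winner ty p) := by
  rw [leftSum_movedRow_of_ne h v h, movedRow_rauzyMap,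
    leftSum_slide_self (movedRow_loser ty p) h, leftSum_slide_of_ne (movedRow_loser ty p) h v h]
  congr 1
  refine Finset.sum_congr rfl fun b hb => ?_
  rw [Function.update_of_ne]
  rintro rfl
  simp at hb

theorem leftSum_fixedRow_winner (ty : ArrowType) (p : CombData A) (v : A → ℝ) :
    leftSum (p.fixedRow ty) (backVec ty p v) (winner ty p) + v (winner ty p) = ∑ a, v a := by
  have := leftSum_last (fixedRow_winner ty p) (backVec ty p v)
  rw [sum_backVec, backVec_winner] at this
  linarith

omit [DecidableEq A] in
theorem movedRow_rauzyMap_ne_zero {ty : ArrowType} {p : CombData A} {a : A}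
    (h : (p.movedRow ty a : ℕ) ≠ 0) : ((rauzyMap ty p).movedRow ty a : ℕ) ≠ 0 := by
  rw [movedRow_rauzyMap]
  simp only [Equiv.trans_apply, slide, Equiv.coe_fn_mk]
  split_ifs <;> simp_all

/-- All partial sums are those of the later time, except the one before the loser in the moved row,
which becomes the total sum of `τ`. The type of the backward arrow is chosen so that this total has
the required sign. -/
theorem IsSuspension.back {ty : ArrowType} {p : CombData A} {τ : A → ℝ}
    (h : IsSuspension (rauzyMap ty p) τ)
    (ht : ty = .top → ∑ a, τ a < 0) (hb : ty = .bottom → 0 < ∑ a, τ a) :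
    IsSuspension p (backVec ty p τ) := by
  have hne := winner_ne_loser h
  rw [isSuspension_iff] at h ⊢
  cases ty
  · refine ⟨fun a ha => ?_, fun a ha => ?_⟩
    · rw [show p.top = p.fixedRow .top from rfl, leftSum_fixedRow]
      exact h.1 a ha
    · rw [show p.bot = p.movedRow .top from rfl]
      by_cases hl : a = loser .top p
      · rw [hl, leftSum_movedRow_loser hne]
        exact ht rfl
      · rw [leftSum_movedRow_of_ne hne _ hl]
        exact h.2 a (movedRow_rauzyMap_ne_zero (ty := .top) ha)
  · refine ⟨fun a ha => ?_, fun a ha => ?_⟩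
    · rw [show p.top = p.movedRow .bottom from rfl]
      by_cases hl : a = loser .bottom p
      · rw [hl, leftSum_movedRow_loser hne]
        exact hb rfl
      · rw [leftSum_movedRow_of_ne hne _ hl]
        exact h.1 a (movedRow_rauzyMap_ne_zero (ty := .bottom) ha)
    · rw [show p.bot = p.fixedRow .bottom from rfl, leftSum_fixedRow]
      exact h.2 a ha

omit [Nontrivial A] [DecidableEq A] in
theorem omegaMatrix_mulVec_rows (ty : ArrowType) (p : CombData A) (v : A → ℝ) (a : A) :
    (omegaMatrix p *ᵥ v) a = (match ty with | .top => 1 | .bottom => -1) *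
      (leftSum (p.movedRow ty) v a - leftSum (p.fixedRow ty) v a) := by
  rw [omegaMatrix_mulVec]
  cases ty <;> simp [CombData.movedRow, CombData.fixedRow]

/-- The relation `Ω_{π'} = B Ω_π ᵗB`, applied to a vector. -/
theorem omegaMatrix_rauzyMap {ty : ArrowType} {p : CombData A}
    (h : winner ty p ≠ loser ty p) (v : A → ℝ) (a : A) :
    (omegaMatrix (rauzyMap ty p) *ᵥ v) a = (omegaMatrix p *ᵥ backVec ty p v) a +
      if a = loser ty p then (omegaMatrix p *ᵥ backVec ty p v) (winner ty p) else 0 := by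
  simp only [omegaMatrix_mulVec_rows ty]
  rw [← leftSum_fixedRow]
  split_ifs with ha
  · subst ha
    rw [leftSum_movedRow_rauzyMap_loser h, leftSum_movedRow_loser h]
    rw [← leftSum_fixedRow_winner ty p v]
    ring
  · rw [leftSum_movedRow_of_ne h _ ha, add_zero]

end Step

/-! ### Interval exchanges and the itineraries of their points -/

section Iem

variable {A : Type*} [Fintype A]

theorem mem_topInterval {p : CombData A} {v : A → ℝ} {a : A} {x : ℝ} :
    x ∈ topInterval p v a ↔ leftSum p.top v a < x ∧ x < leftSum p.top v a + v a := by
  rw [topInterval, mem_Ioo, leftEnd_eq, rightEnd_eq]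

theorem eq_of_mem_Ico {p : CombData A} {v : A → ℝ} (hv : ∀ a, 0 < v a) {a b : A} {x : ℝ}
    (ha : x ∈ Ico (leftEnd p v a) (rightEnd p v a))
    (hb : x ∈ Ico (leftEnd p v b) (rightEnd p v b)) : a = b := by
  rw [leftEnd_eq, rightEnd_eq, mem_Ico] at ha hb
  by_contra hne
  rcases lt_or_gt_of_ne (p.top.injective.ne hne) with h | h
  · linarith [leftSum_add_le hv h]
  · linarith [leftSum_add_le hv h]

theorem iem_of_mem {p : CombData A} {v : A → ℝ} (hv : ∀ a, 0 < v a) {a : A} {x : ℝ}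
    (hx : x ∈ topInterval p v a) : iem p v x = x + translation p v a := by
  have hx' := Ioo_subset_Ico_self hx
  rw [iem, Finset.sum_eq_single a, indicator_of_mem hx']
  · intro b _ hb
    exact indicator_of_notMem (fun h => hb (eq_of_mem_Ico hv h hx')) _
  · simp

/-- The point `x` visits successively the intervals labelled by the letters of the word. -/
def Follows (p : CombData A) (v : A → ℝ) : List A → ℝ → Prop
  | [], _ => True
  | c :: W, x => x ∈ topInterval p v c ∧ Follows p v W (iem p v x)

variable [Nontrivial A]

/-- The substitution on words attached to an arrow: the loser is replaced by the word which
describes the itinerary of its interval. -/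
def substLetter [DecidableEq A] (ty : ArrowType) (p : CombData A) (c : A) : List A :=
  if c = loser ty p then
    match ty with
    | .top => [loser .top p, winner .top p]
    | .bottom => [winner .bottom p, loser .bottom p]
  else [c]

variable [DecidableEq A]

theorem translation_rauzyMap {ty : ArrowType} {p : CombData A}
    (h : winner ty p ≠ loser ty p) (v : A → ℝ) (a : A) :
    translation (rauzyMap ty p) v a = translation p (backVec ty p v) a +
      if a = loser ty p then translation p (backVec ty p v) (winner ty p) else 0 :=
  omegaMatrix_rauzyMap h v a

theorem backVec_pos {ty : ArrowType} {p : CombData A} {v : A → ℝ} (hv : ∀ a, 0 < v a) (a : A) :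
    0 < backVec ty p v a := by
  by_cases h : a = winner ty p
  · rw [h, backVec_winner]
    exact add_pos (hv _) (hv _)
  · rw [backVec_of_ne h]
    exact hv a

theorem le_backVec {ty : ArrowType} {p : CombData A} {v : A → ℝ} (hv : ∀ a, 0 < v a) (a : A) :
    v a ≤ backVec ty p v a := by
  by_cases h : a = winner ty p
  · rw [h, backVec_winner]
    linarith [hv (loser ty p)]
  · rw [backVec_of_ne h]

theorem topInterval_subset_of_ne {ty : ArrowType} {p : CombData A}
    (h : winner ty p ≠ loser ty p) {v : A → ℝ} (hv : ∀ a, 0 < v a) {a : A}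
    (ha : a ≠ loser ty p) :
    topInterval (rauzyMap ty p) v a ⊆ topInterval p (backVec ty p v) a := by
  intro x hx
  rw [mem_topInterval] at hx ⊢
  have := le_backVec (ty := ty) (p := p) hv a
  have e : leftSum p.top (backVec ty p v) a = leftSum (rauzyMap ty p).top v a := by
    cases ty
    · exact leftSum_fixedRow .top p v a
    · exact leftSum_movedRow_of_ne (ty := .bottom) h v ha
  rw [e]
  constructor <;> linarith

/-- The later map is the first return of the earlier one to an interval shorter by the length of the
loser. Only points of the loser's interval leave it, and they come back after one more iteration,
through the winner's interval: after the loser's for top type, before it for bottom type. -/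
theorem follows_substLetter {ty : ArrowType} {p : CombData A}
    (h : winner ty p ≠ loser ty p) {v : A → ℝ} (hv : ∀ a, 0 < v a) {c : A} {x : ℝ}
    (hx : x ∈ topInterval (rauzyMap ty p) v c) {W : List A}
    (hW : Follows p (backVec ty p v) W (iem (rauzyMap ty p) v x)) :
    Follows p (backVec ty p v) (substLetter ty p c ++ W) x := by
  have hv1 := backVec_pos (ty := ty) (p := p) hv
  rw [iem_of_mem hv hx, translation_rauzyMap h] at hW
  by_cases hc : c = loser ty p
  · subst hc
    rw [if_pos rfl] at hW
    rw [mem_topInterval] at hx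
    simp only [substLetter, if_true]
    have ew := hv1 (winner ty p)
    rw [backVec_winner] at ew
    have hl := backVec_of_ne h.symm v
    have hl0 := hv (loser ty p)
    have hw0 := hv (winner ty p)
    cases ty
    -- Top type: the loser's interval is sent onto the rightmost part, of length `v (loser)`, of the
    -- winner's enlarged interval, which is last in the top row.
    · simp only [List.cons_append, List.nil_append, Follows]
      have h1 : x ∈ topInterval p (backVec .top p v) (loser .top p) := by
        rw [mem_topInterval, hl]
        have := leftSum_fixedRow .top p v (loser .top p)
        simp only [CombData.fixedRow] at this
        rwa [this]
      have e1 := iem_of_mem hv1 h1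
      have h2 : x + translation p (backVec .top p v) (loser .top p)
          ∈ topInterval p (backVec .top p v) (winner .top p) := by
        have a1 := leftSum_fixedRow .top p v (loser .top p)
        have a2 := leftSum_movedRow_loser h v
        have a3 := leftSum_fixedRow_winner .top p v
        simp only [CombData.fixedRow, CombData.movedRow] at a1 a2 a3
        rw [mem_topInterval, translation_apply, backVec_winner]
        constructor <;> linarith
      have e2 := iem_of_mem hv1 h2
      refine ⟨h1, by rwa [e1], ?_⟩
      rw [e1, e2, add_assoc]
      exact hW
    -- Bottom type: the later interval of the loser is the right part of the winner's enlarged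
    -- interval, and is sent onto the loser's interval, last in the earlier top row.
    · simp only [List.cons_append, List.nil_append, Follows]
      have b0 := leftSum_movedRow_rauzyMap_loser h v
      have b1 := leftSum_movedRow_loser h v
      have b2 := leftSum_fixedRow_winner .bottom p v
      simp only [CombData.fixedRow, CombData.movedRow] at b0 b1 b2
      have h1 : x ∈ topInterval p (backVec .bottom p v) (winner .bottom p) := by
        rw [mem_topInterval, backVec_winner]
        constructor <;> linarith
      have e1 := iem_of_mem hv1 h1
      have h2 : x + translation p (backVec .bottom p v) (winner .bottom p)
          ∈ topInterval p (backVec .bottom p v) (loser .bottom p) := by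
        rw [mem_topInterval, translation_apply, hl]
        constructor <;> linarith
      have e2 := iem_of_mem hv1 h2
      refine ⟨h1, by rwa [e1], ?_⟩
      rw [e1, e2, add_assoc, add_comm (translation _ _ _)]
      exact hW
  · rw [if_neg hc, add_zero] at hW
    have hx' := topInterval_subset_of_ne h hv hc hx
    have he : substLetter ty p c = [c] := by simp [substLetter, hc]
    rw [he, List.singleton_append]
    exact ⟨hx', by rwa [iem_of_mem hv1 hx']⟩

theorem Follows.subst {ty : ArrowType} {p : CombData A}
    (h : winner ty p ≠ loser ty p) {v : A → ℝ} (hv : ∀ a, 0 < v a) :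
    ∀ {W : List A} {x : ℝ}, Follows (rauzyMap ty p) v W x →
      Follows p (backVec ty p v) (W.flatMap (substLetter ty p)) x
  | [], _, _ => trivial
  | c :: W, x, hx => by
    rw [List.flatMap_cons]
    exact follows_substLetter h hv hx.1 (Follows.subst h hv hx.2)

omit [Nontrivial A] [DecidableEq A] in
theorem Follows.iterate_mem {p : CombData A} {v : A → ℝ} :
    ∀ {W : List A} {x : ℝ}, Follows p v W x → ∀ (j : ℕ) (hj : j < W.length),
      (iem p v)^[j] x ∈ topInterval p v W[j]
  | _ :: _, _, h, 0, _ => h.1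
  | _ :: W, _, h, j + 1, hj => by
    simpa using Follows.iterate_mem (W := W) h.2 j (by simpa using hj)

end Iem

/-! ### Birkhoff sums along words and their behaviour under substitution -/

section Words

variable {A : Type*} [DecidableEq A]

/-- The sum of `f` over the points `x + ∑_{i < j} q (W i)`, for the places `j` of the word `W`
which carry the letter `b`. -/
def wordSum (q : A → ℝ) : List A → A → (ℝ → ℝ) → ℝ → ℝ
  | [], _, _, _ => 0
  | c :: W, b, f, x => (if c = b then f x else 0) + wordSum q W b f (x + q c)

theorem wordSum_eq (q : A → ℝ) (b : A) (f : ℝ → ℝ) :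
    ∀ (W : List A) (vis : ℕ → A) (x : ℝ), (∀ (j : ℕ) (hj : j < W.length), vis j = W[j]) →
      ∑ j ∈ Finset.range W.length with vis j = b, f (x + ∑ i ∈ Finset.range j, q (vis i))
        = wordSum q W b f x
  | [], _, _, _ => by simp [wordSum]
  | c :: W, vis, x, h => by
    have h0 : vis 0 = c := h 0 (by simp)
    have ih := wordSum_eq q b f W (fun j => vis (j + 1)) (x + q c)
      (fun j hj => h (j + 1) (by simpa using hj))
    rw [wordSum, ← ih, Finset.sum_filter, List.length_cons, Finset.sum_range_succ', add_comm,
      Finset.sum_filter]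
    simp only [Finset.sum_range_succ', h0, Finset.range_zero, Finset.sum_empty, add_zero]
    congr 1
    refine Finset.sum_congr rfl fun j _ => ?_
    rw [add_assoc, add_comm (q c)]

variable [Fintype A] [Nontrivial A]

theorem count_flatMap_substLetter {ty : ArrowType} {p : CombData A}
    (h : winner ty p ≠ loser ty p) (b : A) (W : List A) :
    (W.flatMap (substLetter ty p)).count b
      = W.count b + if b = winner ty p then W.count (loser ty p) else 0 := by
  induction W with
  | nil => simp
  | cons c W ih =>
    rw [List.flatMap_cons, List.count_append, ih]
    have : (substLetter ty p c).count b = (if c = b then 1 else 0) +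
        if b = winner ty p then (if c = loser ty p then 1 else 0) else 0 := by
      unfold substLetter
      by_cases hc : c = loser ty p
      · subst hc
        rw [if_pos rfl]
        cases ty <;> simp only [List.count_cons, List.count_nil, beq_iff_eq, if_true, zero_add,
          eq_comm (a := b)]
        all_goals omega
      · simp [hc, List.count_cons]
    rw [this]
    simp only [List.count_cons, beq_iff_eq]
    split_ifs <;> omega

/-- The translation applied to the argument of `ψ_b` by one step of the dual Birkhoff sums. -/
def ownShift (ty : ArrowType) (p : CombData A) (q : A → ℝ) (b : A) : ℝ :=
  if b = loser ty p then
    match ty with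
    | .top => 0
    | .bottom => q (winner ty p)
  else 0

/-- The translation which places the winner's vertical interval in the loser's one. -/
def winnerShift (ty : ArrowType) (p : CombData A) (q : A → ℝ) : ℝ :=
  match ty with
  | .top => q (loser ty p)
  | .bottom => 0

/-- One step of the dual Birkhoff sums. -/
def stepSum (ty : ArrowType) (p : CombData A) (q : A → ℝ) (ψ : A → ℝ → ℝ) : A → ℝ → ℝ :=
  fun b x => ψ b (x + ownShift ty p q b) +
    if b = winner ty p then ψ (loser ty p) (x + winnerShift ty p q) else 0

/-- The vector `q'` is the later vector of heights. Since `q' (loser)` is the total height of the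
two letters replacing the loser, substitution does not move the points attached to the other places
of the word. In the inserted pair the second letter is shifted by the height of the first. -/
theorem wordSum_flatMap {ty : ArrowType} {p : CombData A} (h : winner ty p ≠ loser ty p)
    (q q' : A → ℝ) (hq : ∀ a, q' a = q a + if a = loser ty p then q (winner ty p) else 0)
    (f : ℝ → ℝ) (b : A) (W : List A) (x : ℝ) :
    wordSum q (W.flatMap (substLetter ty p)) b f x
      = stepSum ty p q (fun c => wordSum q' W c f) b x := by
  induction W generalizing x with
  | nil => simp [wordSum, stepSum]
  | cons c W ih =>
    rw [List.flatMap_cons]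
    by_cases hc : c = loser ty p
    · subst hc
      have hql := hq (loser ty p)
      rw [if_pos rfl] at hql
      cases ty
      · have hσ : substLetter .top p (loser .top p) = [loser .top p, winner .top p] := by
          simp [substLetter]
        rw [hσ]
        simp only [List.cons_append, List.nil_append, wordSum, ih, stepSum, hql]
        by_cases hb : b = winner .top p
        · subst hb
          simp only [ownShift, winnerShift, if_neg h, if_neg h.symm, if_true]
          ring_nf
        · simp only [ownShift, winnerShift, if_neg hb, if_neg (Ne.symm hb), ite_self]
          ring_nf
      · have hσ : substLetter .bottom p (loser .bottom p)
            = [winner .bottom p, loser .bottom p] := by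
          simp [substLetter]
        rw [hσ]
        simp only [List.cons_append, List.nil_append, wordSum, ih, stepSum, hql]
        by_cases hb : b = winner .bottom p
        · subst hb
          simp only [ownShift, winnerShift, if_neg h, if_neg h.symm, if_true]
          ring_nf
        · by_cases hb' : b = loser .bottom p
          · subst hb'
            simp only [ownShift, winnerShift, if_neg h, if_neg h.symm, if_true]
            ring_nf
          · simp only [ownShift, winnerShift, if_neg hb, if_neg (Ne.symm hb), if_neg hb',
              if_neg (Ne.symm hb')]
            ring_nf
    · have hσ : substLetter ty p c = [c] := by simp [substLetter, hc]
      have hqc := hq c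
      rw [if_neg hc, add_zero] at hqc
      rw [hσ]
      simp only [List.singleton_append, wordSum, ih, stepSum, hqc, if_neg hc]
      have e1 : (if c = b then f x else 0) = if c = b then f (x + ownShift ty p q b) else 0 := by
        split_ifs with h'
        · subst h'
          simp [ownShift, hc]
        · rfl
      rw [e1, add_right_comm x (q c), add_right_comm x (q c)]
      split_ifs <;> ring

end Words

/-! ### The backward sequence: itineraries, iterated steps, transport of bounds and integrals -/

section Sequence

variable {A : Type*} [Fintype A] [DecidableEq A] [Nontrivial A]

/-- The loser of the arrow `γ_{-n}`. -/
def loserAt (p : CombData A) (τ : A → ℝ) (n : ℕ) : A :=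
  loser (typeAt p τ n) (piAt p τ (n + 1))

/-- The itinerary of `I_a^(0)` in the intervals of level `-n`. -/
def word (p : CombData A) (τ : A → ℝ) : ℕ → A → List A
  | 0, a => [a]
  | n + 1, a => (word p τ n a).flatMap (substLetter (typeAt p τ n) (piAt p τ (n + 1)))

theorem rauzyMap_piAt (p : CombData A) (τ : A → ℝ) (n : ℕ) :
    rauzyMap (typeAt p τ n) (piAt p τ (n + 1)) = piAt p τ n := by
  simp [piAt, backData, typeAt, tauAt]

theorem kz_self (p : CombData A) (τ : A → ℝ) (m : ℕ) : kz p τ m m = 1 := by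
  simp [kz]

theorem kz_add (p : CombData A) (τ : A → ℝ) (m k j : ℕ) :
    kz p τ (m + k + j) m = kz p τ (m + k) m * kz p τ (m + k + j) (m + k) := by
  have h : List.range' m (k + j) = List.range' m k ++ List.range' (m + k) j := by
    simp
  simp only [kz, add_tsub_cancel_left, ← List.prod_append, ← List.map_append]
  rw [add_assoc, add_tsub_cancel_left, h]

theorem kz_succ_apply (p : CombData A) (τ : A → ℝ) (m k : ℕ) (a b : A) :
    kz p τ (m + k + 1) m a b = kz p τ (m + k) m a b +
      if b = winnerAt p τ (m + k) then kz p τ (m + k) m a (loserAt p τ (m + k)) else 0 := by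
  have h1 : kz p τ (m + k + 1) (m + k)
      = arrowMatrix (typeAt p τ (m + k)) (piAt p τ (m + k + 1)) := by
    simp [kz]
  rw [kz_add, h1, arrowMatrix, mul_add, mul_one, Matrix.add_apply]
  congr 1
  rw [Matrix.mul_apply]
  simp only [Matrix.single_apply]
  split_ifs with h
  · rw [Finset.sum_eq_single (loserAt p τ (m + k))]
    · simp [loserAt, h, winnerAt]
    · intro c _ hc
      simp [loserAt] at hc ⊢
      exact fun h' => (hc h'.symm).elim
    · simp
  · refine Finset.sum_eq_zero fun c _ => ?_
    have : winner (typeAt p τ (m + k)) (piAt p τ (m + k + 1)) ≠ b := fun h' => h h'.symm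
    simp [this]

variable {p : CombData A} {τ : A → ℝ}

theorem isSuspension_at (hs : IsSuspension p τ) (hp : HasBackwardPath p τ) (n : ℕ) :
    IsSuspension (piAt p τ n) (tauAt p τ n) := by
  induction n with
  | zero => exact hs
  | succ n ih =>
    rw [← rauzyMap_piAt] at ih
    refine ih.back (fun h => ?_) (fun h => ?_)
    · by_contra hlt
      rw [typeAt, backType, if_neg hlt] at h
      cases h
    · refine lt_of_le_of_ne (not_lt.1 fun hlt => ?_) (hp n).symm
      rw [typeAt, backType, if_pos hlt] at h
      cases h

theorem winnerAt_ne_loserAt (hs : IsSuspension p τ) (hp : HasBackwardPath p τ) (n : ℕ) :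
    winnerAt p τ n ≠ loserAt p τ n := by
  have h := isSuspension_at hs hp n
  rw [← rauzyMap_piAt] at h
  exact winner_ne_loser h

theorem omegaMatrix_piAt (hs : IsSuspension p τ) (hp : HasBackwardPath p τ) (n : ℕ)
    (v : A → ℝ) (a : A) :
    (omegaMatrix (piAt p τ n) *ᵥ v) a
      = (omegaMatrix (piAt p τ (n + 1)) *ᵥ backVec (typeAt p τ n) (piAt p τ (n + 1)) v) a +
        if a = loserAt p τ n then (omegaMatrix (piAt p τ (n + 1)) *ᵥ
          backVec (typeAt p τ n) (piAt p τ (n + 1)) v) (winnerAt p τ n) else 0 := by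
  have := omegaMatrix_rauzyMap (winnerAt_ne_loserAt hs hp n) v a
  rwa [rauzyMap_piAt] at this

theorem qAt_pos (hs : IsSuspension p τ) (hp : HasBackwardPath p τ) (n : ℕ) (a : A) :
    0 < qAt p τ n a := heights_pos (isSuspension_at hs hp n) a

theorem qAt_eq (hs : IsSuspension p τ) (hp : HasBackwardPath p τ) (n : ℕ) (a : A) :
    qAt p τ n a = qAt p τ (n + 1) a +
      if a = loserAt p τ n then qAt p τ (n + 1) (winnerAt p τ n) else 0 := by
  simp only [qAt, heights, Pi.neg_apply, omegaMatrix_piAt hs hp n]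
  have : tauAt p τ (n + 1) = backVec (typeAt p τ n) (piAt p τ (n + 1)) (tauAt p τ n) := rfl
  rw [← this]
  split_ifs <;> ring

theorem lenAt_pos {l : A → ℝ} (hl : ∀ a, 0 < l a) (n : ℕ) : ∀ a, 0 < lenAt p τ l n a := by
  induction n with
  | zero => exact hl
  | succ n ih => exact backVec_pos ih

theorem count_word (hs : IsSuspension p τ) (hp : HasBackwardPath p τ) (n : ℕ) (a b : A) :
    (word p τ n a).count b = kz p τ n 0 a b := by
  induction n generalizing b with
  | zero => simp [word, kz_self, List.count_cons, Matrix.one_apply]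
  | succ n ih =>
    have := kz_succ_apply p τ 0 n a b
    rw [zero_add] at this
    rw [this, word, count_flatMap_substLetter (winnerAt_ne_loserAt hs hp n), ih, ih]
    rfl

theorem length_word (hs : IsSuspension p τ) (hp : HasBackwardPath p τ) (n : ℕ) (a : A) :
    (word p τ n a).length = rowSum p τ n 0 a := by
  simp only [rowSum, ← count_word hs hp]
  rw [← Multiset.coe_card, ← Multiset.sum_count_eq_card (s := Finset.univ) (by simp)]
  simp

theorem follows_word (hs : IsSuspension p τ) (hp : HasBackwardPath p τ) {l : A → ℝ}
    (hl : ∀ a, 0 < l a) (n : ℕ) {a : A} {x : ℝ} (hx : x ∈ intervalAt p τ l 0 a) :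
    Follows (piAt p τ n) (lenAt p τ l n) (word p τ n a) x := by
  induction n with
  | zero => exact ⟨hx, trivial⟩
  | succ n ih =>
    rw [← rauzyMap_piAt] at ih
    exact ih.subst (winnerAt_ne_loserAt hs hp n) (lenAt_pos hl n)

theorem intervalAt_nonempty {l : A → ℝ} (hl : ∀ a, 0 < l a) (a : A) :
    (intervalAt p τ l 0 a).Nonempty := by
  rw [intervalAt, topInterval, nonempty_Ioo, leftEnd_eq, rightEnd_eq]
  exact lt_add_of_pos_right _ (hl a)

/-- The itinerary shows that a suitable letter exists, so the choice made in `visit` is meaningful;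
it is unique because a nonempty image cannot lie in two disjoint intervals. -/
theorem visit_eq (hs : IsSuspension p τ) (hp : HasBackwardPath p τ) {l : A → ℝ}
    (hl : ∀ a, 0 < l a) (n : ℕ) (a : A) (j : ℕ) (hj : j < (word p τ n a).length) :
    visit p τ l n 0 a j = (word p τ n a)[j] := by
  have h1 : (iemAt p τ l n)^[j] '' intervalAt p τ l 0 a
      ⊆ intervalAt p τ l n ((word p τ n a)[j]) := by
    rintro _ ⟨x, hx, rfl⟩
    exact (follows_word hs hp hl n hx).iterate_mem j hj
  have h2 := Classical.epsilon_spec (p := fun b =>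
    (iemAt p τ l n)^[j] '' intervalAt p τ l 0 a ⊆ intervalAt p τ l n b) ⟨_, h1⟩
  obtain ⟨x, hx⟩ := intervalAt_nonempty (p := p) (τ := τ) hl a
  exact eq_of_mem_Ico (lenAt_pos hl n) (Ioo_subset_Ico_self (h2 (mem_image_of_mem _ hx)))
    (Ioo_subset_Ico_self (h1 (mem_image_of_mem _ hx)))

/-- One step of the dual Birkhoff sums, from functions on `L^(-n)` to functions on `L^(-n-1)`. -/
def stepAt (p : CombData A) (τ : A → ℝ) (n : ℕ) (ψ : A → ℝ → ℝ) : A → ℝ → ℝ :=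
  stepSum (typeAt p τ n) (piAt p τ (n + 1)) (qAt p τ (n + 1)) ψ

/-- The composition of `k` steps of the dual Birkhoff sums, from level `-m`. -/
def iterSum (p : CombData A) (τ : A → ℝ) (m : ℕ) : ℕ → (A → ℝ → ℝ) → A → ℝ → ℝ
  | 0, ψ => ψ
  | k + 1, ψ => stepAt p τ (m + k) (iterSum p τ m k ψ)

theorem stepSum_sum (ty : ArrowType) (p : CombData A) (q : A → ℝ) (ψ : A → A → ℝ → ℝ)
    (b : A) (x : ℝ) :
    stepSum ty p q (fun b x => ∑ a, ψ a b x) b x = ∑ a, stepSum ty p q (ψ a) b x := by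
  simp only [stepSum, Finset.sum_add_distrib]
  split_ifs <;> simp

/-- The right-hand side does not contain `l`: the itineraries, and with them the dual sums, depend
only on `p` and `τ`. -/
theorem dualBirkhoff_eq_iterSum (hs : IsSuspension p τ) (hp : HasBackwardPath p τ) {l : A → ℝ}
    (hl : ∀ a, 0 < l a) (n : ℕ) (ψ : A → ℝ → ℝ) :
    dualBirkhoff p τ l 0 n ψ = iterSum p τ 0 n ψ := by
  have key : iterSum p τ 0 n ψ
      = fun b x => ∑ a, wordSum (qAt p τ n) (word p τ n a) b (ψ a) x := by
    induction n with
    | zero =>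
      ext b x
      simp [iterSum, word, wordSum]
    | succ n ih =>
      ext b x
      rw [iterSum, zero_add, ih, stepAt, stepSum_sum]
      refine Finset.sum_congr rfl fun a _ => ?_
      exact (wordSum_flatMap (winnerAt_ne_loserAt hs hp n) _ _ (qAt_eq hs hp n) _ _ _ _).symm
  rw [key]
  ext b x
  refine Finset.sum_congr rfl fun a _ => ?_
  rw [← length_word hs hp]
  exact wordSum_eq _ _ _ _ _ _ (visit_eq hs hp hl n a)

theorem iterSum_add (m k j : ℕ) (ψ : A → ℝ → ℝ) :
    iterSum p τ m (k + j) ψ = iterSum p τ (m + k) j (iterSum p τ m k ψ) := by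
  induction j with
  | zero => rfl
  | succ j ih => rw [← add_assoc, iterSum, ih, iterSum, add_assoc]

/-- The action of `ᵗB(-m-k, -m)` on vectors. -/
def iterVec (p : CombData A) (τ : A → ℝ) (m : ℕ) : ℕ → (A → ℝ) → A → ℝ
  | 0, v => v
  | k + 1, v => backVec (typeAt p τ (m + k)) (piAt p τ (m + k + 1)) (iterVec p τ m k v)

theorem iterVec_succ_apply (m k : ℕ) (v : A → ℝ) (b : A) :
    iterVec p τ m (k + 1) v b = iterVec p τ m k v b +
      if b = winnerAt p τ (m + k) then iterVec p τ m k v (loserAt p τ (m + k)) else 0 := by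
  split_ifs with h
  · subst h
    exact backVec_winner _ _ _
  · rw [add_zero]
    exact backVec_of_ne h _

theorem iterVec_add (m k j : ℕ) (v : A → ℝ) :
    iterVec p τ m (k + j) v = iterVec p τ (m + k) j (iterVec p τ m k v) := by
  induction j with
  | zero => rfl
  | succ j ih =>
    rw [← add_assoc, iterVec, ih, iterVec]
    simp only [← add_assoc]

theorem iterVec_eq (m k : ℕ) (v : A → ℝ) (b : A) :
    iterVec p τ m k v b = ∑ a, v a * kz p τ (m + k) m a b := by
  induction k generalizing b with
  | zero => simp [iterVec, kz_self, Matrix.one_apply]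
  | succ k ih =>
    rw [iterVec_succ_apply, ih, ih]
    simp only [← add_assoc, kz_succ_apply, Nat.cast_add, mul_add, Finset.sum_add_distrib]
    split_ifs <;> simp

/-! ### Behaviour of the steps on functions -/

theorem stepAt_add (n : ℕ) (ψ φ : A → ℝ → ℝ) :
    stepAt p τ n (ψ + φ) = stepAt p τ n ψ + stepAt p τ n φ := by
  ext b x
  simp only [stepAt, stepSum, Pi.add_apply]
  split_ifs <;> ring

theorem iterSum_add_fun (m k : ℕ) (ψ φ : A → ℝ → ℝ) :
    iterSum p τ m k (ψ + φ) = iterSum p τ m k ψ + iterSum p τ m k φ := by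
  induction k with
  | zero => rfl
  | succ k ih => rw [iterSum, ih, stepAt_add]; rfl

theorem iterSum_const (m k : ℕ) (u : A → ℝ) :
    iterSum p τ m k (fun b _ => u b) = fun b _ => iterVec p τ m k u b := by
  induction k with
  | zero => rfl
  | succ k ih =>
    ext b x
    rw [iterSum, ih, iterVec_succ_apply]
    rfl

theorem add_ownShift_mem (hs : IsSuspension p τ) (hp : HasBackwardPath p τ) (n : ℕ) {b : A}
    {x : ℝ} (hx : x ∈ vertInterval p τ (n + 1) b) :
    x + ownShift (typeAt p τ n) (piAt p τ (n + 1)) (qAt p τ (n + 1)) b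
      ∈ vertInterval p τ n b := by
  have hw := qAt_pos hs hp (n + 1) (winnerAt p τ n)
  rw [vertInterval, mem_Ioo] at hx ⊢
  rw [qAt_eq hs hp n]
  by_cases hb : b = loserAt p τ n
  · have hb' : b = loser (typeAt p τ n) (piAt p τ (n + 1)) := hb
    simp only [if_pos hb, ownShift, if_pos hb']
    simp only [winnerAt] at *
    generalize typeAt p τ n = ty at *
    cases ty <;> simp only <;> constructor <;> linarith
  · have hb' : b ≠ loser (typeAt p τ n) (piAt p τ (n + 1)) := hb
    simpa only [if_neg hb, ownShift, if_neg hb', add_zero] using hx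

theorem add_winnerShift_mem (hs : IsSuspension p τ) (hp : HasBackwardPath p τ) (n : ℕ)
    {x : ℝ} (hx : x ∈ vertInterval p τ (n + 1) (winnerAt p τ n)) :
    x + winnerShift (typeAt p τ n) (piAt p τ (n + 1)) (qAt p τ (n + 1))
      ∈ vertInterval p τ n (loserAt p τ n) := by
  have hl := qAt_pos hs hp (n + 1) (loserAt p τ n)
  rw [vertInterval, mem_Ioo] at hx ⊢
  rw [qAt_eq hs hp n, if_pos rfl]
  unfold winnerShift
  simp only [winnerAt, loserAt] at *
  generalize typeAt p τ n = ty at *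
  cases ty <;> simp only <;> constructor <;> linarith

/-- A bound which holds on `L^(-m)` is transported by `ᵗB`. -/
theorem abs_iterSum_le (hs : IsSuspension p τ) (hp : HasBackwardPath p τ) {m : ℕ}
    {ψ : A → ℝ → ℝ} {c : A → ℝ} (h : ∀ b, ∀ x ∈ vertInterval p τ m b, |ψ b x| ≤ c b) (k : ℕ) :
    ∀ b, ∀ x ∈ vertInterval p τ (m + k) b, |iterSum p τ m k ψ b x| ≤ iterVec p τ m k c b := by
  induction k with
  | zero => exact h
  | succ k ih =>
    intro b x hx
    rw [iterSum, iterVec_succ_apply, stepAt, stepSum]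
    refine (abs_add_le _ _).trans (add_le_add (ih b _ (add_ownShift_mem hs hp _ hx)) ?_)
    change |if b = winnerAt p τ (m + k) then _ else _| ≤ _
    split_ifs with hb
    · subst hb
      exact ih _ _ (add_winnerShift_mem hs hp _ hx)
    · simp

/-- A modulus of continuity on the intervals of `L^(-m)` is transported by `ᵗB`. -/
theorem abs_iterSum_sub_le (hs : IsSuspension p τ) (hp : HasBackwardPath p τ) {m : ℕ}
    {ψ : A → ℝ → ℝ} {c : A → ℝ} {g : ℝ → ℝ}
    (h : ∀ b, ∀ x ∈ vertInterval p τ m b, ∀ y ∈ vertInterval p τ m b,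
      |ψ b x - ψ b y| ≤ c b * g (x - y)) (k : ℕ) :
    ∀ b, ∀ x ∈ vertInterval p τ (m + k) b, ∀ y ∈ vertInterval p τ (m + k) b,
      |iterSum p τ m k ψ b x - iterSum p τ m k ψ b y| ≤ iterVec p τ m k c b * g (x - y) := by
  induction k with
  | zero => exact h
  | succ k ih =>
    intro b x hx y hy
    rw [iterSum, iterVec_succ_apply, stepAt, stepSum, stepSum, add_sub_add_comm, add_mul]
    refine (abs_add_le _ _).trans (add_le_add ?_ ?_)
    · have := ih b _ (add_ownShift_mem hs hp _ hx) _ (add_ownShift_mem hs hp _ hy)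
      rwa [add_sub_add_right_eq_sub] at this
    change |(if b = winnerAt p τ (m + k) then _ else _) -
      if b = winnerAt p τ (m + k) then _ else _| ≤ _
    split_ifs with hb
    · subst hb
      have := ih _ _ (add_winnerShift_mem hs hp _ hx) _ (add_winnerShift_mem hs hp _ hy)
      rwa [add_sub_add_right_eq_sub] at this
    · simp

theorem integral_vertInterval (hs : IsSuspension p τ) (hp : HasBackwardPath p τ) (n : ℕ) (b : A)
    (f : ℝ → ℝ) : ∫ x in vertInterval p τ n b, f x = ∫ x in (0 : ℝ)..qAt p τ n b, f x := by
  rw [intervalIntegral.integral_of_le (qAt_pos hs hp n b).le, integral_Ioc_eq_integral_Ioo]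
  rfl

theorem integrableOn_vertInterval_iff (hs : IsSuspension p τ) (hp : HasBackwardPath p τ) (n : ℕ)
    (b : A) (f : ℝ → ℝ) : IntegrableOn f (vertInterval p τ n b) ↔
      IntervalIntegrable f volume 0 (qAt p τ n b) := by
  rw [intervalIntegrable_iff_integrableOn_Ioo_of_le (qAt_pos hs hp n b).le]
  rfl

/-- The loser's vertical interval at time `-n` is the concatenation of those of the loser and the
winner at time `-n-1`, with the loser's first for top type and the winner's first for bottom type.
-/
theorem loser_integral_split (hs : IsSuspension p τ) (hp : HasBackwardPath p τ) (n : ℕ)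
    {f : ℝ → ℝ} (hf : IntervalIntegrable f volume 0 (qAt p τ n (loserAt p τ n))) :
    let s := ownShift (typeAt p τ n) (piAt p τ (n + 1)) (qAt p τ (n + 1)) (loserAt p τ n)
    let t := winnerShift (typeAt p τ n) (piAt p τ (n + 1)) (qAt p τ (n + 1))
    IntervalIntegrable (fun x => f (x + s)) volume 0 (qAt p τ (n + 1) (loserAt p τ n)) ∧
    IntervalIntegrable (fun x => f (x + t)) volume 0 (qAt p τ (n + 1) (winnerAt p τ n)) ∧
    (∫ x in (0 : ℝ)..qAt p τ (n + 1) (loserAt p τ n), f (x + s)) +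
      (∫ x in (0 : ℝ)..qAt p τ (n + 1) (winnerAt p τ n), f (x + t))
      = ∫ x in (0 : ℝ)..qAt p τ n (loserAt p τ n), f x := by
  have hl := qAt_pos hs hp (n + 1) (loserAt p τ n)
  have hw := qAt_pos hs hp (n + 1) (winnerAt p τ n)
  have hq := qAt_eq hs hp n (loserAt p τ n)
  rw [if_pos rfl] at hq
  intro s t
  have sub : ∀ a b : ℝ, 0 ≤ a → a ≤ b → b ≤ qAt p τ n (loserAt p τ n) →
      IntervalIntegrable f volume a b := fun a b h0 h1 h2 => by
    refine hf.mono_set ?_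
    rw [uIcc_of_le h1, uIcc_of_le (h0.trans (h1.trans h2))]
    exact Icc_subset_Icc h0 h2
  have hst : (s = 0 ∧ t = qAt p τ (n + 1) (loserAt p τ n)) ∨
      (s = qAt p τ (n + 1) (winnerAt p τ n) ∧ t = 0) := by
    simp only [s, t, ownShift, winnerShift, winnerAt, loserAt, if_true]
    generalize typeAt p τ n = ty
    cases ty <;> simp
  have tr : ∀ r c : ℝ, 0 ≤ r → 0 ≤ c → r + c ≤ qAt p τ n (loserAt p τ n) →
      IntervalIntegrable (fun x => f (x + r)) volume 0 c := fun r c hr hc h => by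
    have := (sub r (c + r) hr (by linarith) (by linarith)).comp_add_right r
    simpa using this
  rcases hst with ⟨h1, h2⟩ | ⟨h1, h2⟩
  · rw [h1, h2]
    refine ⟨tr _ _ le_rfl hl.le (by linarith), tr _ _ hl.le hw.le (by linarith), ?_⟩
    rw [intervalIntegral.integral_comp_add_right, intervalIntegral.integral_comp_add_right,
      zero_add, add_zero, zero_add, intervalIntegral.integral_add_adjacent_intervals, hq]
    · rw [add_comm]
    · exact sub _ _ le_rfl hl.le (by linarith)
    · exact sub _ _ hl.le (by linarith) (by linarith)
  · rw [h1, h2]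
    refine ⟨tr _ _ hw.le hl.le (by linarith), tr _ _ le_rfl hw.le (by linarith), ?_⟩
    rw [add_comm (intervalIntegral _ _ _ _), intervalIntegral.integral_comp_add_right,
      intervalIntegral.integral_comp_add_right,
      zero_add, add_zero, zero_add, intervalIntegral.integral_add_adjacent_intervals, hq]
    · exact sub _ _ le_rfl hw.le (by linarith)
    · exact sub _ _ hw.le (by linarith) (by linarith)

theorem stepAt_integral (hs : IsSuspension p τ) (hp : HasBackwardPath p τ) (n : ℕ)
    {ψ : A → ℝ → ℝ} (h : ∀ b, IntegrableOn (ψ b) (vertInterval p τ n b)) :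
    (∀ b, IntegrableOn (stepAt p τ n ψ b) (vertInterval p τ (n + 1) b)) ∧
      ∑ b, ∫ x in vertInterval p τ (n + 1) b, stepAt p τ n ψ b x
        = ∑ b, ∫ x in vertInterval p τ n b, ψ b x := by
  simp only [integrableOn_vertInterval_iff hs hp, integral_vertInterval hs hp] at h ⊢
  obtain ⟨i1, i2, i3⟩ := loser_integral_split hs hp n (h (loserAt p τ n))
  have hne := winnerAt_ne_loserAt hs hp n
  have own : ∀ b, IntervalIntegrable (fun x => ψ b (x +
      ownShift (typeAt p τ n) (piAt p τ (n + 1)) (qAt p τ (n + 1)) b)) volume 0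
      (qAt p τ (n + 1) b) ∧ (b ≠ loserAt p τ n → (∫ x in (0 : ℝ)..qAt p τ (n + 1) b, ψ b (x +
      ownShift (typeAt p τ n) (piAt p τ (n + 1)) (qAt p τ (n + 1)) b))
        = ∫ x in (0 : ℝ)..qAt p τ n b, ψ b x) := fun b => by
    by_cases hb : b = loserAt p τ n
    · subst hb
      exact ⟨i1, fun hb => (hb rfl).elim⟩
    · have hb' : b ≠ loser (typeAt p τ n) (piAt p τ (n + 1)) := hb
      have hq := qAt_eq hs hp n b
      rw [if_neg hb, add_zero] at hq
      have hi := h b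
      rw [hq] at hi
      simp only [ownShift, if_neg hb', add_zero]
      exact ⟨hi, fun _ => by rw [hq]⟩
  have other : ∀ b, IntervalIntegrable (fun x => if b = winnerAt p τ n then
      ψ (loserAt p τ n) (x + winnerShift (typeAt p τ n) (piAt p τ (n + 1)) (qAt p τ (n + 1)))
      else 0) volume 0 (qAt p τ (n + 1) b) := fun b => by
    by_cases hb : b = winnerAt p τ n
    · subst hb
      simpa using i2
    · simp [hb]
  refine ⟨fun b => (own b).1.add (other b), ?_⟩
  have e : ∀ b, ∫ x in (0 : ℝ)..qAt p τ (n + 1) b, stepAt p τ n ψ b x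
      = (∫ x in (0 : ℝ)..qAt p τ (n + 1) b, ψ b (x +
      ownShift (typeAt p τ n) (piAt p τ (n + 1)) (qAt p τ (n + 1)) b)) +
      if b = winnerAt p τ n then ∫ x in (0 : ℝ)..qAt p τ (n + 1) (winnerAt p τ n),
      ψ (loserAt p τ n) (x + winnerShift (typeAt p τ n) (piAt p τ (n + 1)) (qAt p τ (n + 1)))
      else 0 := fun b => by
    have := intervalIntegral.integral_add (own b).1 (other b)
    refine Eq.trans this ?_
    by_cases hb : b = winnerAt p τ n
    · subst hb
      simp
    · simp [hb]
  simp only [e, Finset.sum_add_distrib, Finset.sum_ite_eq', Finset.mem_univ, if_true]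
  rw [← Finset.add_sum_erase _ _ (Finset.mem_univ (loserAt p τ n)),
    ← Finset.add_sum_erase _ (fun b => ∫ x in (0 : ℝ)..qAt p τ n b, ψ b x)
      (Finset.mem_univ (loserAt p τ n)), add_right_comm, i3]
  congr 1
  exact Finset.sum_congr rfl fun b hb => (own b).2 (Finset.ne_of_mem_erase hb)

theorem iterSum_integral (hs : IsSuspension p τ) (hp : HasBackwardPath p τ) {m : ℕ}
    {ψ : A → ℝ → ℝ} (h : ∀ b, IntegrableOn (ψ b) (vertInterval p τ m b)) (k : ℕ) :
    (∀ b, IntegrableOn (iterSum p τ m k ψ b) (vertInterval p τ (m + k) b)) ∧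
      ∑ b, ∫ x in vertInterval p τ (m + k) b, iterSum p τ m k ψ b x
        = ∑ b, ∫ x in vertInterval p τ m b, ψ b x := by
  induction k with
  | zero => exact ⟨h, rfl⟩
  | succ k ih =>
    have := stepAt_integral hs hp (m + k) ih.1
    exact ⟨this.1, this.2.trans ih.2⟩

end Sequence

/-! ### Growth of supports -/

section Support

variable {A : Type*} [DecidableEq A] {w l : ℕ → A} {S : ℕ → Finset A}

/-- Membership propagates back in time: when the winner changes it was the previous loser, and a
loser in a set that does not grow forces the winner of the same arrow to be in it already. -/
theorem mem_of_winner_mem (hchain : ∀ k, w (k + 1) = w k ∨ w (k + 1) = l k)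
    (hS : ∀ k, S (k + 1) = if l k ∈ S k then insert (w k) (S k) else S k) {T : Finset A} {i : ℕ}
    (k : ℕ) (hT : ∀ j, i ≤ j → j ≤ i + k → S j = T) (hw : w (i + k) ∈ T) : w i ∈ T := by
  induction k with
  | zero => exact hw
  | succ k ih =>
    refine ih (fun j h1 h2 => hT j h1 (by omega)) ?_
    rcases hchain (i + k) with h | h
    · rwa [← h]
    · have h1 := hS (i + k)
      rw [hT (i + k + 1) (by omega) (by omega), hT (i + k) (by omega) (by omega),
        if_pos (by rw [← h]; exact hw)] at h1
      rw [h1]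
      exact Finset.mem_insert_self _ _

theorem support_mono (hS : ∀ k, S (k + 1) = if l k ∈ S k then insert (w k) (S k) else S k) :
    Monotone S := by
  refine monotone_nat_of_le_succ fun k => ?_
  rw [hS]
  split_ifs
  · exact Finset.subset_insert _ _
  · exact le_rfl

/-- Take a letter outside `S m` that wins during the first complete path and one inside that wins
during the second. If `S` were constant, the second membership would propagate back to the first
letter. -/
theorem support_ssubset [Fintype A] (hchain : ∀ k, w (k + 1) = w k ∨ w (k + 1) = l k)
    (hS : ∀ k, S (k + 1) = if l k ∈ S k then insert (w k) (S k) else S k) {m n r : ℕ}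
    (h1 : ∀ a, ∃ j, m ≤ j ∧ j < n ∧ w j = a) (h2 : ∀ a, ∃ j, n ≤ j ∧ j < r ∧ w j = a)
    (hne : (S m).Nonempty) (hu : S m ≠ Finset.univ) : S m ⊂ S r := by
  obtain ⟨b, hb⟩ := hne
  obtain ⟨a, ha⟩ : ∃ a, a ∉ S m := by
    by_contra! h
    exact hu (Finset.eq_univ_iff_forall.2 h)
  obtain ⟨i, hi1, hi2, rfl⟩ := h1 a
  obtain ⟨j, hj1, hj2, rfl⟩ := h2 b
  have mono := support_mono hS
  refine (mono (by omega : m ≤ r)).lt_of_ne fun heq => ha ?_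
  obtain ⟨k, rfl⟩ := Nat.exists_eq_add_of_le (show i ≤ j by omega)
  refine mem_of_winner_mem hchain hS k (T := S m) (fun j' h1 h2 => ?_) hb
  exact le_antisymm ((mono (by omega)).trans heq.ge) (mono (by omega))

theorem support_eq_univ [Fintype A] (hchain : ∀ k, w (k + 1) = w k ∨ w (k + 1) = l k)
    (hS : ∀ k, S (k + 1) = if l k ∈ S k then insert (w k) (S k) else S k) {t : ℕ → ℕ}
    (ht : ∀ k a, ∃ j, t k ≤ j ∧ j < t (k + 1) ∧ w j = a)
    (hne : (S (t 0)).Nonempty) : S (t (2 * Fintype.card A)) = Finset.univ := by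
  obtain ⟨b, hb⟩ := hne
  have mono := support_mono hS
  have htm : Monotone t := monotone_nat_of_le_succ fun k => by
    obtain ⟨j, h1, h2, -⟩ := ht k b
    omega
  have key : ∀ i, S (t (2 * i)) = Finset.univ ∨ i + 1 ≤ (S (t (2 * i))).card := by
    intro i
    induction i with
    | zero => exact Or.inr (Finset.card_pos.2 ⟨b, hb⟩)
    | succ i ih =>
      by_cases hu : S (t (2 * i)) = Finset.univ
      · refine Or.inl (Finset.univ_subset_iff.1 ?_)
        rw [← hu]
        exact mono (htm (by omega))
      · right
        have h := ih.resolve_left hu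
        have := Finset.card_lt_card (support_ssubset hchain hS (ht (2 * i)) (ht (2 * i + 1))
          ⟨b, mono (htm (by omega)) hb⟩ hu)
        have e : 2 * (i + 1) = 2 * i + 1 + 1 := by ring
        rw [e]
        omega
  rcases key (Fintype.card A) with h | h
  · exact h
  · exact absurd (Finset.card_le_univ (S (t (2 * Fintype.card A)))) (by omega)

end Support

/-! ### Positivity, norms and balance of the matrices of the backward path -/

section Matrices

variable {A : Type*} [Fintype A] [DecidableEq A] [Nontrivial A] {p : CombData A} {τ : A → ℝ}

/-- The winner of the arrow ending at a vertex is last in one of the two rows there, and these last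
letters are the winner and the loser of the arrow starting from that vertex. -/
theorem winnerAt_succ (p : CombData A) (τ : A → ℝ) (n : ℕ) :
    winnerAt p τ (n + 1) = winnerAt p τ n ∨ winnerAt p τ (n + 1) = loserAt p τ n := by
  have h1 : (piAt p τ (n + 1)).fixedRow (typeAt p τ (n + 1)) (winnerAt p τ (n + 1))
      = lastPos A := by
    have := fixedRow_rauzyMap (typeAt p τ (n + 1)) (piAt p τ (n + 1 + 1))
    rw [rauzyMap_piAt] at this
    rw [this]
    exact fixedRow_winner _ _
  have h2 := fixedRow_winner (typeAt p τ n) (piAt p τ (n + 1))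
  have h3 := movedRow_loser (typeAt p τ n) (piAt p τ (n + 1))
  change winnerAt p τ (n + 1) = winner (typeAt p τ n) (piAt p τ (n + 1)) ∨
    winnerAt p τ (n + 1) = loser (typeAt p τ n) (piAt p τ (n + 1))
  revert h1 h2 h3
  generalize winnerAt p τ (n + 1) = x
  generalize winner (typeAt p τ n) (piAt p τ (n + 1)) = y
  generalize loser (typeAt p τ n) (piAt p τ (n + 1)) = z
  generalize typeAt p τ n = s
  generalize typeAt p τ (n + 1) = t
  intro h1 h2 h3
  cases s <;> cases t <;> simp only [CombData.fixedRow, CombData.movedRow] at h1 h2 h3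
  · exact Or.inl (Equiv.injective _ (h1.trans h2.symm))
  · exact Or.inr (Equiv.injective _ (h1.trans h3.symm))
  · exact Or.inr (Equiv.injective _ (h1.trans h3.symm))
  · exact Or.inl (Equiv.injective _ (h1.trans h2.symm))

theorem kz_mono (p : CombData A) (τ : A → ℝ) (m : ℕ) (a b : A) :
    Monotone fun k => kz p τ (m + k) m a b :=
  monotone_nat_of_le_succ fun k => by
    rw [← add_assoc, kz_succ_apply]
    exact Nat.le_add_right _ _

theorem one_le_kz_diag (p : CombData A) (τ : A → ℝ) (m k : ℕ) (a : A) :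
    1 ≤ kz p τ (m + k) m a a := by
  have := kz_mono p τ m a a (Nat.zero_le k)
  simpa [kz_self] using this

/-- A concatenation of `2d` complete paths has a positive matrix. -/
theorem kz_pos_of_complete {t : ℕ → ℕ} (ht : ∀ k, CompletePath p τ (t (k + 1)) (t k)) (a b : A) :
    0 < kz p τ (t (2 * Fintype.card A)) (t 0) a b := by
  have htm : Monotone t := monotone_nat_of_le_succ fun k => by
    obtain ⟨j, h1, h2, -⟩ := ht k a
    omega
  -- The support of row `a`: multiplication by an arrow matrix adds the column of the loser to that
  -- of the winner.
  let S : ℕ → Finset A := fun k => Finset.univ.filter fun c => 0 < kz p τ (t 0 + k) (t 0) a c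
  have hS : ∀ k, S (k + 1) = if loserAt p τ (t 0 + k) ∈ S k then
      insert (winnerAt p τ (t 0 + k)) (S k) else S k := by
    intro k
    ext c
    simp only [S, Finset.mem_filter, Finset.mem_univ, true_and, ← add_assoc, kz_succ_apply]
    split_ifs with h1 h2 h2 <;> simp_all
  have h := support_eq_univ (t := fun k => t k - t 0) (w := fun k => winnerAt p τ (t 0 + k))
    (fun k => winnerAt_succ p τ (t 0 + k)) hS (fun k c => by
      obtain ⟨j, h1, h2, h3⟩ := ht k c
      have := htm (Nat.zero_le k)
      refine ⟨j - t 0, by omega, by omega, ?_⟩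
      rw [Nat.add_sub_of_le (by omega), h3])
    ⟨a, by simp [S, kz_self]⟩
  have hb := Finset.mem_univ b
  rw [← h] at hb
  simp only [S, Finset.mem_filter, Finset.mem_univ, true_and] at hb
  rwa [Nat.add_sub_of_le (htm (Nat.zero_le _))] at hb

theorem accTime_spec (h : InfinitelyComplete p τ) (k : ℕ) :
    accTime p τ k < accTime p τ (k + 1) ∧
      CompletePath p τ (accTime p τ (k + 1)) (accTime p τ k) := by
  obtain ⟨s, hs, -, hc⟩ := h
  have hle := hs.le_apply (x := accTime p τ k)
  have hlt := hs (Nat.lt_succ_self (accTime p τ k))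
  have hne : {n : ℕ | accTime p τ k < n ∧ CompletePath p τ n (accTime p τ k)}.Nonempty := by
    refine ⟨s (accTime p τ k + 1), hle.trans_lt hlt, fun a => ?_⟩
    obtain ⟨j, h1, h2, h3⟩ := hc (accTime p τ k) a
    exact ⟨j, hle.trans h1, h2, h3⟩
  exact Nat.sInf_mem hne

theorem accTime_strictMono (h : InfinitelyComplete p τ) : StrictMono (accTime p τ) :=
  strictMono_nat_of_lt_succ fun k => (accTime_spec h k).1

theorem kz_accTime_pos (h : InfinitelyComplete p τ) (k : ℕ) (a b : A) :
    0 < kz p τ (accTime p τ (k + 2 * Fintype.card A)) (accTime p τ k) a b :=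
  kz_pos_of_complete (t := fun i => accTime p τ (k + i)) (fun i => (accTime_spec h (k + i)).2) a b

theorem kz_mul (p : CombData A) (τ : A → ℝ) {m n r : ℕ} (h1 : m ≤ n) (h2 : n ≤ r) :
    kz p τ r m = kz p τ n m * kz p τ r n := by
  obtain ⟨k, rfl⟩ := Nat.exists_eq_add_of_le h1
  obtain ⟨j, rfl⟩ := Nat.exists_eq_add_of_le h2
  exact kz_add p τ m k j

/-! ### Norms of matrices -/

omit [DecidableEq A] [Nontrivial A] in
theorem matNorm_nonneg (B : Matrix A A ℕ) : 0 ≤ matNorm B :=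
  Finset.sum_nonneg fun _ _ => Finset.sum_nonneg fun _ _ => Nat.cast_nonneg _

omit [DecidableEq A] [Nontrivial A] in
theorem matNorm_transpose (B : Matrix A A ℕ) : matNorm Bᵀ = matNorm B :=
  Finset.sum_comm

omit [DecidableEq A] [Nontrivial A] in
theorem colSum_le_matNorm (B : Matrix A A ℕ) (b : A) : ∑ a, (B a b : ℝ) ≤ matNorm B :=
  Finset.sum_le_sum fun a _ =>
    Finset.single_le_sum (f := fun c => (B a c : ℝ)) (fun _ _ => Nat.cast_nonneg _)
      (Finset.mem_univ b)

omit [DecidableEq A] [Nontrivial A] in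
theorem rowSum_le_matNorm (B : Matrix A A ℕ) (a : A) : ∑ b, (B a b : ℝ) ≤ matNorm B :=
  Finset.single_le_sum (f := fun a => ∑ b, (B a b : ℝ))
    (fun _ _ => Finset.sum_nonneg fun _ _ => Nat.cast_nonneg _) (Finset.mem_univ a)

omit [DecidableEq A] [Nontrivial A] in
theorem matNorm_mul_eq (B C : Matrix A A ℕ) :
    matNorm (B * C) = ∑ c, (∑ a, (B a c : ℝ)) * ∑ b, (C c b : ℝ) := by
  simp only [matNorm, Matrix.mul_apply, Nat.cast_sum, Nat.cast_mul, Finset.sum_mul_sum]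
  rw [Finset.sum_congr rfl fun a _ => Finset.sum_comm, Finset.sum_comm]

omit [DecidableEq A] [Nontrivial A] in
theorem matNorm_mul_le (B C : Matrix A A ℕ) : matNorm (B * C) ≤ matNorm B * matNorm C := by
  rw [matNorm_mul_eq, show matNorm C = ∑ c, ∑ b, (C c b : ℝ) from rfl, Finset.mul_sum]
  exact Finset.sum_le_sum fun c _ => mul_le_mul_of_nonneg_right (colSum_le_matNorm B c)
    (Finset.sum_nonneg fun _ _ => Nat.cast_nonneg _)

omit [DecidableEq A] [Nontrivial A] in
theorem matNorm_le_colSum_mul {B C : Matrix A A ℕ} (hC : ∀ a b, 0 < C a b) (b : A) :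
    matNorm B ≤ ∑ a, ((B * C) a b : ℝ) := by
  refine Finset.sum_le_sum fun a _ => ?_
  rw [Matrix.mul_apply, Nat.cast_sum]
  refine Finset.sum_le_sum fun c _ => ?_
  exact_mod_cast Nat.le_mul_of_pos_right _ (hC c b)

omit [DecidableEq A] [Nontrivial A] in
theorem mul_le_matNorm_mul {B C : Matrix A A ℕ} {x : ℝ} (h : ∀ b, x ≤ ∑ a, (B a b : ℝ)) :
    x * matNorm C ≤ matNorm (B * C) := by
  rw [matNorm_mul_eq, show matNorm C = ∑ c, ∑ b, (C c b : ℝ) from rfl, Finset.mul_sum]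
  exact Finset.sum_le_sum fun c _ => mul_le_mul_of_nonneg_right (h c)
    (Finset.sum_nonneg fun _ _ => Nat.cast_nonneg _)

theorem one_le_colSum_kz (p : CombData A) (τ : A → ℝ) (n : ℕ) (b : A) :
    (1 : ℝ) ≤ ∑ a, (kz p τ n 0 a b : ℝ) := by
  have h := one_le_kz_diag p τ 0 n b
  rw [zero_add] at h
  refine le_trans (by exact_mod_cast h) (Finset.single_le_sum (f := fun a => (kz p τ n 0 a b : ℝ))
      (fun _ _ => Nat.cast_nonneg _) (Finset.mem_univ b))

theorem one_le_matNorm_kz (p : CombData A) (τ : A → ℝ) (n : ℕ) : 1 ≤ matNorm (kz p τ n 0) := by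
  obtain ⟨b⟩ := (inferInstance : Nonempty A)
  exact (one_le_colSum_kz p τ n b).trans (colSum_le_matNorm _ b)

theorem matNorm_kz_succ (p : CombData A) (τ : A → ℝ) (n : ℕ) :
    matNorm (kz p τ n 0) + 1 ≤ matNorm (kz p τ (n + 1) 0) := by
  have h : ∀ a b, kz p τ (n + 1) 0 a b = kz p τ n 0 a b +
      if b = winnerAt p τ n then kz p τ n 0 a (loserAt p τ n) else 0 := fun a b => by
    have := kz_succ_apply p τ 0 n a b
    rwa [zero_add] at this
  have := one_le_colSum_kz p τ n (loserAt p τ n)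
  simp only [matNorm, h, Nat.cast_add, Finset.sum_add_distrib]
  simpa using this

theorem matNorm_kz_strictMono (p : CombData A) (τ : A → ℝ) :
    StrictMono fun n => matNorm (kz p τ n 0) :=
  strictMono_nat_of_lt_succ fun n => by linarith [matNorm_kz_succ p τ n]

theorem nat_le_matNorm_kz (p : CombData A) (τ : A → ℝ) (n : ℕ) :
    (n : ℝ) ≤ matNorm (kz p τ n 0) := by
  induction n with
  | zero => simpa using matNorm_nonneg _
  | succ n ih =>
    push_cast
    linarith [matNorm_kz_succ p τ n]

/-! ### Consequences of the growth condition -/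

/-- `‖B(n̂_{-k}, 0)‖`. -/
def accNorm (p : CombData A) (τ : A → ℝ) (k : ℕ) : ℝ := matNorm (kz p τ (accTime p τ k) 0)

theorem one_le_accNorm (p : CombData A) (τ : A → ℝ) (k : ℕ) : 1 ≤ accNorm p τ k :=
  one_le_matNorm_kz p τ _

theorem accNorm_strictMono (h : InfinitelyComplete p τ) : StrictMono (accNorm p τ) :=
  (matNorm_kz_strictMono p τ).comp (accTime_strictMono h)

theorem accNorm_succ_le (h : InfinitelyComplete p τ) (hg : DualMatrixGrowth p τ) {ε : ℝ}
    (hε : 0 < ε) : ∃ C : ℝ, 1 ≤ C ∧ ∀ k, accNorm p τ (k + 1)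
      ≤ accNorm p τ k * (C * accNorm p τ k ^ ε) := by
  obtain ⟨C, hC, hk⟩ := hg ε hε
  refine ⟨max C 1, le_max_right _ _, fun k => ?_⟩
  have h0 := one_le_accNorm p τ k
  rw [accNorm, kz_mul p τ (Nat.zero_le _) (accTime_spec h k).1.le]
  refine (matNorm_mul_le _ _).trans (mul_le_mul_of_nonneg_left ((hk k).trans ?_) (matNorm_nonneg _))
  exact mul_le_mul_of_nonneg_right (le_max_left _ _) (by positivity)

theorem accNorm_add_le (h : InfinitelyComplete p τ) (hg : DualMatrixGrowth p τ) {ε : ℝ}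
    (hε : 0 < ε) (r : ℕ) : ∃ C : ℝ, 1 ≤ C ∧ ∀ k, accNorm p τ (k + r) ^ (1 - ε)
      ≤ C * accNorm p τ k := by
  have hr : (0 : ℝ) < r + 1 := by positivity
  -- Each of the `r` steps costs a power `ε / (r + 1)`, hence less than `ε` in all; the denominator
  -- is also nonzero for `r = 0`.
  have hδ : 0 < ε / (r + 1) := by positivity
  obtain ⟨C, hC, hk⟩ := accNorm_succ_le h hg hδ
  refine ⟨C ^ r, one_le_pow₀ hC, fun k => ?_⟩
  set δ := ε / (r + 1)
  -- By monotonicity all growth factors are estimated at the last time, so that they can be moved to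
  -- the left-hand side as a single power.
  have key : ∀ s, accNorm p τ (k + s) ≤ accNorm p τ k * (C * accNorm p τ (k + s) ^ δ) ^ s := by
    intro s
    induction s with
    | zero => simp
    | succ s ih =>
      have h1 := one_le_accNorm p τ (k + s)
      have hk1 := one_le_accNorm p τ k
      have hmono : accNorm p τ (k + s) ≤ accNorm p τ (k + (s + 1)) :=
        (accNorm_strictMono h).monotone (by omega)
      have h3 : C * accNorm p τ (k + s) ^ δ ≤ C * accNorm p τ (k + (s + 1)) ^ δ := by gcongr
      calc accNorm p τ (k + (s + 1)) ≤ accNorm p τ (k + s) * (C * accNorm p τ (k + s) ^ δ) :=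
            hk (k + s)
        _ ≤ (accNorm p τ k * (C * accNorm p τ (k + s) ^ δ) ^ s) *
              (C * accNorm p τ (k + s) ^ δ) := by gcongr
        _ = accNorm p τ k * (C * accNorm p τ (k + s) ^ δ) ^ (s + 1) := by ring
        _ ≤ accNorm p τ k * (C * accNorm p τ (k + (s + 1)) ^ δ) ^ (s + 1) := by gcongr
  have hX := one_le_accNorm p τ (k + r)
  have hX0 : 0 < accNorm p τ (k + r) := by linarith
  have h1 := key r
  have h2 : (accNorm p τ (k + r) ^ δ) ^ r ≤ accNorm p τ (k + r) ^ ε := by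
    rw [← Real.rpow_natCast, ← Real.rpow_mul hX0.le]
    refine Real.rpow_le_rpow_of_exponent_le hX ?_
    rw [div_mul_eq_mul_div, div_le_iff₀ hr]
    nlinarith
  rw [Real.rpow_sub hX0, Real.rpow_one, div_le_iff₀ (by positivity)]
  have hk0 := one_le_accNorm p τ k
  calc accNorm p τ (k + r) ≤ accNorm p τ k * (C * accNorm p τ (k + r) ^ δ) ^ r := h1
    _ = C ^ r * accNorm p τ k * (accNorm p τ (k + r) ^ δ) ^ r := by rw [mul_pow]; ring
    _ ≤ C ^ r * accNorm p τ k * accNorm p τ (k + r) ^ ε := by gcongr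

/-- The columns of `B(n̂_{-k}, 0)` are almost balanced. -/
theorem accNorm_le_colSum (h : InfinitelyComplete p τ) (hg : DualMatrixGrowth p τ) {ε : ℝ}
    (hε : 0 < ε) (hε1 : ε < 1) : ∃ C : ℝ, 1 ≤ C ∧ ∀ k b, accNorm p τ k ^ (1 - ε)
      ≤ C * ∑ a, (kz p τ (accTime p τ k) 0 a b : ℝ) := by
  set r := 2 * Fintype.card A
  obtain ⟨C, hC, hk⟩ := accNorm_add_le h hg hε r
  refine ⟨max C (accNorm p τ r), hC.trans (le_max_left _ _), fun k b => ?_⟩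
  have hcol := one_le_colSum_kz p τ (accTime p τ k) b
  rcases le_total k r with hkr | hkr
  -- The first times, not preceded by `r` complete paths, are absorbed in the constant.
  · have h1 := one_le_accNorm p τ k
    calc accNorm p τ k ^ (1 - ε) ≤ accNorm p τ k ^ (1 : ℝ) :=
          Real.rpow_le_rpow_of_exponent_le h1 (by linarith)
      _ = accNorm p τ k := Real.rpow_one _
      _ ≤ accNorm p τ r := (accNorm_strictMono h).monotone hkr
      _ ≤ max C (accNorm p τ r) := le_max_right _ _
      _ ≤ _ := le_mul_of_one_le_right (by linarith [le_max_left C (accNorm p τ r)]) hcol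
  · obtain ⟨i, rfl⟩ := Nat.exists_eq_add_of_le' hkr
    -- The last `r` complete paths give a matrix with entries at least `1`, so each column of the
    -- product sums to at least the whole norm of the first factor.
    have h2 : accNorm p τ i ≤ ∑ a, (kz p τ (accTime p τ (i + r)) 0 a b : ℝ) := by
      rw [kz_mul p τ (Nat.zero_le (accTime p τ i))
        ((accTime_strictMono h).monotone (Nat.le_add_right i r))]
      exact matNorm_le_colSum_mul (kz_accTime_pos h i) b
    refine (hk i).trans (mul_le_mul (le_max_left _ _) h2 ?_ ?_)
    · linarith [one_le_accNorm p τ i]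
    · linarith [le_max_left C (accNorm p τ r)]

end Matrices

/-! ### Action of the transposed matrices on vectors -/

section Vectors

variable {A : Type*} [Fintype A] [DecidableEq A] [Nontrivial A] {p : CombData A} {τ : A → ℝ}

theorem norm_iterVec_le (m k : ℕ) (v : A → ℝ) :
    ‖iterVec p τ m k v‖ ≤ ‖v‖ * matNorm (kz p τ (m + k) m) := by
  refine (pi_norm_le_iff_of_nonneg (mul_nonneg (norm_nonneg _) (matNorm_nonneg _))).2 fun b => ?_
  rw [iterVec_eq]
  calc ‖∑ a, v a * kz p τ (m + k) m a b‖ ≤ ∑ a, ‖v‖ * kz p τ (m + k) m a b := by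
        refine norm_sum_le_of_le _ fun a _ => ?_
        rw [norm_mul, Real.norm_natCast]
        exact mul_le_mul_of_nonneg_right (norm_le_pi_norm v a) (Nat.cast_nonneg _)
    _ = ‖v‖ * ∑ a, (kz p τ (m + k) m a b : ℝ) := by rw [Finset.mul_sum]
    _ ≤ _ := mul_le_mul_of_nonneg_left (colSum_le_matNorm _ b) (norm_nonneg _)

theorem iterVec_sub (m k : ℕ) (u v : A → ℝ) :
    iterVec p τ m k (u - v) = iterVec p τ m k u - iterVec p τ m k v := by
  ext b
  simp [iterVec_eq, sub_mul]

theorem iterVec_surjective (hs : IsSuspension p τ) (hp : HasBackwardPath p τ) (m k : ℕ) :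
    Function.Surjective (iterVec p τ m k) := by
  induction k with
  | zero => exact fun v => ⟨v, rfl⟩
  | succ k ih =>
    intro u
    have hne := winnerAt_ne_loserAt hs hp (m + k)
    obtain ⟨v, hv⟩ := ih (Function.update u (winnerAt p τ (m + k))
      (u (winnerAt p τ (m + k)) - u (loserAt p τ (m + k))))
    refine ⟨v, ?_⟩
    ext b
    rw [iterVec_succ_apply, hv]
    split_ifs with h
    · subst h
      simp [hne.symm]
    · simp [h]

/-- A sequence of vectors transported forward by the arrows is transported by `B`. -/
theorem eq_sum_kz_mul {f : ℕ → A → ℝ} (hf : ∀ n a, f n a = f (n + 1) a +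
    if a = loserAt p τ n then f (n + 1) (winnerAt p τ n) else 0) (n : ℕ) (a : A) :
    f 0 a = ∑ b, (kz p τ n 0 a b : ℝ) * f n b := by
  induction n with
  | zero => simp [kz_self, Matrix.one_apply]
  | succ n ih =>
    have h : ∀ b, kz p τ (n + 1) 0 a b = kz p τ n 0 a b +
        if b = winnerAt p τ n then kz p τ n 0 a (loserAt p τ n) else 0 := fun b => by
      have := kz_succ_apply p τ 0 n a b
      rwa [zero_add] at this
    rw [ih]
    simp only [h, hf n, mul_add, Nat.cast_add, add_mul, Finset.sum_add_distrib, Nat.cast_ite,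
      mul_ite, ite_mul, Nat.cast_zero, zero_mul, mul_zero]
    simp

theorem qAt_zero_eq (hs : IsSuspension p τ) (hp : HasBackwardPath p τ) (n : ℕ) (a : A) :
    qAt p τ 0 a = ∑ b, (kz p τ n 0 a b : ℝ) * qAt p τ n b :=
  eq_sum_kz_mul (qAt_eq hs hp) n a

theorem omegaMatrix_zero_eq (hs : IsSuspension p τ) (hp : HasBackwardPath p τ) (n : ℕ)
    (v : A → ℝ) (a : A) : (omegaMatrix p *ᵥ v) a
      = ∑ b, (kz p τ n 0 a b : ℝ) * (omegaMatrix (piAt p τ n) *ᵥ iterVec p τ 0 n v) b := by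
  refine eq_sum_kz_mul (f := fun n => omegaMatrix (piAt p τ n) *ᵥ iterVec p τ 0 n v)
    (fun n a => ?_) n a
  have := omegaMatrix_piAt hs hp n (iterVec p τ 0 n v) a
  simpa [iterVec] using this

theorem sum_mul_qAt (hs : IsSuspension p τ) (hp : HasBackwardPath p τ) (n : ℕ) (v : A → ℝ) :
    ∑ b, iterVec p τ 0 n v b * qAt p τ n b = ∑ a, v a * qAt p τ 0 a := by
  simp only [iterVec_eq, qAt_zero_eq hs hp n, Finset.sum_mul, Finset.mul_sum, zero_add]
  rw [Finset.sum_comm]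
  simp only [mul_assoc]

omit [DecidableEq A] [Nontrivial A] in
theorem abs_omegaMatrix_mulVec_le (p : CombData A) (v : A → ℝ) (a : A) :
    |(omegaMatrix p *ᵥ v) a| ≤ Fintype.card A * ‖v‖ := by
  have h : ∀ b, |omegaMatrix p a b * v b| ≤ ‖v‖ := fun b => by
    have h1 : |omegaMatrix p a b| ≤ 1 := by
      unfold omegaMatrix
      split_ifs <;> simp
    rw [abs_mul]
    calc _ ≤ 1 * |v b| := mul_le_mul_of_nonneg_right h1 (abs_nonneg _)
      _ ≤ ‖v‖ := by rw [one_mul]; exact norm_le_pi_norm v b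
  calc _ ≤ ∑ b, |omegaMatrix p a b * v b| := Finset.abs_sum_le_sum_abs _ _
    _ ≤ ∑ _b : A, ‖v‖ := Finset.sum_le_sum fun b _ => h b
    _ = _ := by simp

/-- By Ω_0 = B Ω_n ᵗB, the vector Ωv is recovered from ᵗBv at the cost of a single factor ‖B‖,
without inverting ᵗB. -/
theorem norm_omegaMatrix_zero_le (hs : IsSuspension p τ) (hp : HasBackwardPath p τ) (n : ℕ)
    (v : A → ℝ) : ‖omegaMatrix p *ᵥ v‖
      ≤ matNorm (kz p τ n 0) * (Fintype.card A * ‖iterVec p τ 0 n v‖) := by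
  have h0 := matNorm_nonneg (kz p τ n 0)
  refine (pi_norm_le_iff_of_nonneg (by positivity)).2 fun a => ?_
  rw [omegaMatrix_zero_eq hs hp n]
  calc _ ≤ ∑ b, (kz p τ n 0 a b : ℝ) * (Fintype.card A * ‖iterVec p τ 0 n v‖) := by
        refine norm_sum_le_of_le _ fun b _ => ?_
        rw [norm_mul, Real.norm_natCast]
        exact mul_le_mul_of_nonneg_left (abs_omegaMatrix_mulVec_le _ _ _) (Nat.cast_nonneg _)
    _ ≤ _ := by
        rw [← Finset.sum_mul]
        exact mul_le_mul_of_nonneg_right (rowSum_le_matNorm _ a) (by positivity)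

omit [DecidableEq A] [Nontrivial A] in
theorem sum_mul_omegaMatrix_mulVec (p : CombData A) (u v : A → ℝ) :
    ∑ a, u a * (omegaMatrix p *ᵥ v) a = -∑ a, (omegaMatrix p *ᵥ u) a * v a := by
  have anti : ∀ a b, omegaMatrix p a b = -omegaMatrix p b a := fun a b => by
    unfold omegaMatrix
    split_ifs <;> grind
  simp only [mulVec, dotProduct, Finset.mul_sum, Finset.sum_mul, ← Finset.sum_neg_distrib]
  rw [Finset.sum_comm]
  refine Finset.sum_congr rfl fun b _ => Finset.sum_congr rfl fun a _ => ?_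
  rw [anti a b]
  ring

/-! ### The kernel of `Ω` -/

omit [DecidableEq A] [Nontrivial A] in
theorem abs_leftSum_le (e : A ≃ Fin (Fintype.card A)) (v : A → ℝ) (a : A) :
    |leftSum e v a| ≤ Fintype.card A * ‖v‖ := by
  rw [leftSum_eq_sum_ite]
  calc _ ≤ ∑ b, |if e b < e a then v b else 0| := Finset.abs_sum_le_sum_abs _ _
    _ ≤ ∑ _b : A, ‖v‖ := Finset.sum_le_sum fun b _ => by
        split_ifs
        · exact norm_le_pi_norm v b
        · simp
    _ = _ := by simp

omit [DecidableEq A] [Nontrivial A] in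
theorem leftSum_bot_eq {p : CombData A} {v : A → ℝ} (h : omegaMatrix p *ᵥ v = 0) (a : A) :
    leftSum p.bot v a = leftSum p.top v a := by
  have := congrFun h a
  rw [omegaMatrix_mulVec] at this
  exact sub_eq_zero.1 this

/-- `v` is in the kernel of `Ω` and the endpoints of the corresponding intervals are bounded. -/
def KernelBound (p : CombData A) (v : A → ℝ) (M : ℝ) : Prop :=
  omegaMatrix p *ᵥ v = 0 ∧ ∀ a, |leftSum p.top v a| ≤ M ∧ |leftSum p.top v a + v a| ≤ M

/-- On the kernel the partial sums of the two rows agree, so each may be computed in the fixed row,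
where it does not change. The only new right endpoint, that of the winner, is the left endpoint of
the loser before the move. Thus no new endpoint appears, and `M` is preserved. -/
theorem KernelBound.back {ty : ArrowType} {p : CombData A} (hne : winner ty p ≠ loser ty p)
    {v : A → ℝ} {M : ℝ} (h : KernelBound (rauzyMap ty p) v M) :
    KernelBound p (backVec ty p v) M := by
  obtain ⟨h0, hb⟩ := h
  have h1 : omegaMatrix p *ᵥ backVec ty p v = 0 := by
    have hw := omegaMatrix_rauzyMap hne v (winner ty p)
    rw [h0, if_neg hne, add_zero] at hw
    ext a
    have ha := omegaMatrix_rauzyMap hne v a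
    rw [h0, ← hw] at ha
    simpa using ha.symm
  have e : ∀ a, leftSum p.top (backVec ty p v) a = leftSum (rauzyMap ty p).top v a := fun a => by
    cases ty
    · exact leftSum_fixedRow .top p v a
    · rw [← leftSum_bot_eq h1, ← leftSum_bot_eq h0]
      exact leftSum_fixedRow .bottom p v a
  refine ⟨h1, fun a => ⟨by rw [e]; exact (hb a).1, ?_⟩⟩
  by_cases ha : a = winner ty p
  · subst ha
    have e2 := leftSum_movedRow_rauzyMap_loser hne v
    have e3 : leftSum (rauzyMap ty p).top v (loser ty p)
        = leftSum p.top (backVec ty p v) (winner ty p) + v (winner ty p) := by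
      cases ty
      · rw [← leftSum_bot_eq h1, ← leftSum_bot_eq h0]
        exact e2
      · exact e2
    rw [backVec_winner, ← add_assoc, ← e3]
    exact (hb _).2
  · rw [backVec_of_ne ha, e]
    exact (hb a).2

omit [DecidableEq A] [Nontrivial A] in
theorem kernelBound_of_eq_zero {p : CombData A} {v : A → ℝ} (hv : omegaMatrix p *ᵥ v = 0) :
    KernelBound p v ((Fintype.card A + 1) * ‖v‖) := by
  refine ⟨hv, fun a => ?_⟩
  have h1 := abs_leftSum_le p.top v a
  have h2 : |v a| ≤ ‖v‖ := norm_le_pi_norm v a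
  have h3 := norm_nonneg v
  have h4 := abs_add_le (leftSum p.top v a) (v a)
  constructor <;> linarith

theorem KernelBound.iterVec (hs : IsSuspension p τ) (hp : HasBackwardPath p τ) {m : ℕ}
    {v : A → ℝ} {M : ℝ} (h : KernelBound (piAt p τ m) v M) (k : ℕ) :
    KernelBound (piAt p τ (m + k)) (iterVec p τ m k v) M := by
  induction k with
  | zero => exact h
  | succ k ih =>
    rw [← rauzyMap_piAt] at ih
    exact ih.back (winnerAt_ne_loserAt hs hp (m + k))

/-- `ᵗB` is bounded on the kernel of `Ω`. -/
theorem norm_iterVec_kernel_le (hs : IsSuspension p τ) (hp : HasBackwardPath p τ) (m k : ℕ)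
    {v : A → ℝ} (hv : omegaMatrix (piAt p τ m) *ᵥ v = 0) :
    ‖iterVec p τ m k v‖ ≤ 2 * ((Fintype.card A + 1) * ‖v‖) := by
  have h1 := (kernelBound_of_eq_zero hv).iterVec hs hp k
  refine (pi_norm_le_iff_of_nonneg (by positivity)).2 fun a => ?_
  -- Each component is the difference of two endpoints bounded by the same `M`.
  obtain ⟨h2, h3⟩ := h1.2 a
  rw [Real.norm_eq_abs]
  rw [abs_le] at *
  constructor <;> linarith

theorem omegaMatrix_iterVec_eq_zero (hs : IsSuspension p τ) (hp : HasBackwardPath p τ) (k : ℕ)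
    {v : A → ℝ} (hv : omegaMatrix p *ᵥ v = 0) :
    omegaMatrix (piAt p τ k) *ᵥ iterVec p τ 0 k v = 0 := by
  have h := (KernelBound.iterVec (p := p) (m := 0) hs hp (kernelBound_of_eq_zero hv) k).1
  rwa [zero_add] at h

omit [DecidableEq A] [Nontrivial A] in
/-- A bounded right inverse of `Ω` on its range. -/
theorem exists_bounded_preimage (p : CombData A) : ∃ K : ℝ, 0 < K ∧ ∀ v : A → ℝ, ∃ v' : A → ℝ,
    omegaMatrix p *ᵥ v' = omegaMatrix p *ᵥ v ∧ ‖v'‖ ≤ K * ‖omegaMatrix p *ᵥ v‖ := by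
  let f : (A → ℝ) →L[ℝ] (LinearMap.range (omegaMatrix p).mulVecLin) :=
    LinearMap.toContinuousLinearMap (omegaMatrix p).mulVecLin.rangeRestrict
  have hf : Function.Surjective f := (omegaMatrix p).mulVecLin.surjective_rangeRestrict
  obtain ⟨K, hK, h⟩ := f.exists_preimage_norm_le hf
  refine ⟨K, hK, fun v => ?_⟩
  obtain ⟨v', h1, h2⟩ := h (f v)
  exact ⟨v', congrArg Subtype.val h1, h2⟩

theorem norm_iterVec_le_of_gap {θ C : ℝ}
    (h : ∀ n, ‖transposeRestrict p τ n 0‖ ≤ C * matNorm (kz p τ n 0)ᵀ ^ (1 - θ)) (n : ℕ)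
    {v : A → ℝ} (hv : ∑ a, v a * qAt p τ 0 a = 0) :
    ‖iterVec p τ 0 n v‖ ≤ C * matNorm (kz p τ n 0) ^ (1 - θ) * ‖v‖ := by
  have h1 := (transposeRestrict p τ n 0).le_of_opNorm_le (h n) ⟨v, hv⟩
  rw [matNorm_transpose] at h1
  have h2 : transposeRestrict p τ n 0 ⟨v, hv⟩ = iterVec p τ 0 n v := by
    ext b
    rw [iterVec_eq, zero_add]
    simp [transposeRestrict, vecMul, dotProduct]
  rw [h2] at h1
  exact h1

end Vectors

/-! ### Short intervals, the intermediate time, and the decomposition into mean values -/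

section Estimates

variable {A : Type*} [Fintype A] [DecidableEq A] [Nontrivial A] {p : CombData A} {τ : A → ℝ}

/-- The intervals of `L^(n̂_{-k})` are short. -/
theorem qAt_accTime_le (hs : IsSuspension p τ) (hp : HasBackwardPath p τ)
    (h : InfinitelyComplete p τ) (hg : DualMatrixGrowth p τ) {ε : ℝ}
    (hε : 0 < ε) (hε1 : ε < 1) : ∃ C : ℝ, 0 < C ∧ ∀ k b,
      qAt p τ (accTime p τ k) b ≤ C * accNorm p τ k ^ (-(1 - ε)) := by
  obtain ⟨C, hC, hk⟩ := accNorm_le_colSum h hg hε hε1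
  obtain ⟨a0⟩ := (inferInstance : Nonempty A)
  have hQ : 0 < ∑ a, qAt p τ 0 a := Finset.sum_pos (fun a _ => qAt_pos hs hp 0 a) ⟨a0, by simp⟩
  refine ⟨C * ∑ a, qAt p τ 0 a, by positivity, fun k b => ?_⟩
  have hX := one_le_accNorm p τ k
  have hX0 : 0 < accNorm p τ k := by linarith
  have hq := qAt_pos hs hp (accTime p τ k)
  -- Total height is conserved, q^(0) = B q^(n), so a large column sum forces a short interval.
  have h1 : (∑ a, (kz p τ (accTime p τ k) 0 a b : ℝ)) * qAt p τ (accTime p τ k) b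
      ≤ ∑ a, qAt p τ 0 a := by
    rw [Finset.sum_mul]
    refine Finset.sum_le_sum fun a _ => ?_
    rw [qAt_zero_eq hs hp (accTime p τ k)]
    exact Finset.single_le_sum
      (f := fun b => (kz p τ (accTime p τ k) 0 a b : ℝ) * qAt p τ (accTime p τ k) b)
      (fun c _ => mul_nonneg (Nat.cast_nonneg _) (hq c).le) (Finset.mem_univ b)
  rw [Real.rpow_neg hX0.le, ← div_eq_mul_inv, le_div_iff₀ (by positivity)]
  calc qAt p τ (accTime p τ k) b * accNorm p τ k ^ (1 - ε)
      ≤ qAt p τ (accTime p τ k) b * (C * ∑ a, (kz p τ (accTime p τ k) 0 a b : ℝ)) :=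
        mul_le_mul_of_nonneg_left (hk k b) (hq b).le
    _ = C * ((∑ a, (kz p τ (accTime p τ k) 0 a b : ℝ)) * qAt p τ (accTime p τ k) b) := by ring
    _ ≤ _ := mul_le_mul_of_nonneg_left h1 (by linarith)

/-- In a product of nonnegative matrices, the norm is at least the smallest column sum of the first
factor times the norm of the second; the column sums are nearly ‖B(n̂,0)‖. -/
theorem matNorm_kz_accTime_le (h : InfinitelyComplete p τ) (hg : DualMatrixGrowth p τ) {ε : ℝ}
    (hε : 0 < ε) (hε1 : ε < 1) : ∃ C : ℝ, 0 < C ∧ ∀ k n, accTime p τ k ≤ n →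
      matNorm (kz p τ n (accTime p τ k))
        ≤ C * matNorm (kz p τ n 0) * accNorm p τ k ^ (-(1 - ε)) := by
  obtain ⟨C, hC, hk⟩ := accNorm_le_colSum h hg hε hε1
  refine ⟨C, by linarith, fun k n hn => ?_⟩
  have hX := one_le_accNorm p τ k
  have hX0 : 0 < accNorm p τ k := by linarith
  rw [Real.rpow_neg hX0.le, ← div_eq_mul_inv, le_div_iff₀ (by positivity)]
  have h1 : accNorm p τ k ^ (1 - ε) / C * matNorm (kz p τ n (accTime p τ k))
      ≤ matNorm (kz p τ n 0) := by
    rw [kz_mul p τ (Nat.zero_le _) hn]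
    refine mul_le_matNorm_mul fun b => ?_
    rw [div_le_iff₀' (by linarith)]
    exact hk k b
  rw [div_mul_eq_mul_div, div_le_iff₀' (by linarith)] at h1
  linarith

/-- The first index at which one of the two upper conditions fails is taken, and `k` is its
predecessor. The factor `accNorm p τ 0` makes index `0` admissible. -/
theorem exists_accTime_between (h : InfinitelyComplete p τ) {s : ℝ} (hs0 : 0 ≤ s) (hs1 : s ≤ 1)
    (n : ℕ) : ∃ k, accTime p τ k ≤ n ∧
      accNorm p τ k ≤ accNorm p τ 0 * matNorm (kz p τ n 0) ^ s ∧
      matNorm (kz p τ n 0) ^ s ≤ accNorm p τ (k + 1) := by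
  classical
  have hY := one_le_matNorm_kz p τ n
  have hX0 := one_le_accNorm p τ 0
  have hYs : 1 ≤ matNorm (kz p τ n 0) ^ s := Real.one_le_rpow hY hs0
  have hex : ∃ k, ¬ (accTime p τ k ≤ n ∧
      accNorm p τ k ≤ accNorm p τ 0 * matNorm (kz p τ n 0) ^ s) :=
    ⟨n + 1, fun h' => by
      have := (accTime_strictMono h).le_apply (x := n + 1)
      omega⟩
  have hf := Nat.find_spec hex
  have hpos : Nat.find hex ≠ 0 := by
    intro h0
    rw [h0] at hf
    exact hf ⟨Nat.zero_le _, by nlinarith⟩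
  obtain ⟨k, hk⟩ := Nat.exists_eq_succ_of_ne_zero hpos
  have hm := not_not.1 (Nat.find_min hex (m := k) (by omega))
  refine ⟨k, hm.1, hm.2, ?_⟩
  rw [hk, not_and_or, not_le, not_le] at hf
  -- Either the next accelerated time is beyond `n`, and its norm exceeds the whole of ‖B(n,0)‖,
  -- where `s ≤ 1` is used, or its norm is too large.
  rcases hf with hf | hf
  · calc matNorm (kz p τ n 0) ^ s ≤ matNorm (kz p τ n 0) ^ (1 : ℝ) :=
          Real.rpow_le_rpow_of_exponent_le hY hs1
      _ = matNorm (kz p τ n 0) := Real.rpow_one _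
      _ ≤ accNorm p τ (k + 1) := (matNorm_kz_strictMono p τ).monotone hf.le
  · refine le_trans ?_ hf.le
    nlinarith

/-- The exponent of the spectral gap is at most `2`. -/
theorem DualSpectralGap.le_two (hs : IsSuspension p τ) (hp : HasBackwardPath p τ) {θ : ℝ}
    (h : DualSpectralGap p τ θ) : θ ≤ 2 := by
  obtain ⟨-, C, hC, hgap⟩ := h
  by_contra! hlt
  have hq : ∀ a, qAt p τ 0 a = -(omegaMatrix p *ᵥ τ) a := fun a => rfl
  -- Since `q = -Ωτ` and Ω is antisymmetric, `τ` itself has zero mean, and the gap applies to it.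
  have hτ : ∑ a, τ a * qAt p τ 0 a = 0 := by
    have h1 := sum_mul_omegaMatrix_mulVec p τ τ
    have h2 : ∑ a, (omegaMatrix p *ᵥ τ) a * τ a = ∑ a, τ a * (omegaMatrix p *ᵥ τ) a :=
      Finset.sum_congr rfl fun a _ => mul_comm _ _
    simp only [hq, mul_neg, Finset.sum_neg_distrib]
    linarith
  have hΩ : 0 < ‖omegaMatrix p *ᵥ τ‖ := by
    obtain ⟨a⟩ := (inferInstance : Nonempty A)
    refine norm_pos_iff.2 fun h0 => ?_
    have := qAt_pos hs hp 0 a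
    rw [hq, h0] at this
    simp at this
  set K := Fintype.card A * (C * ‖τ‖)
  -- The nonzero vector Ωτ = B Ω_n ᵗBτ has norm at most a constant times ‖B‖^(2-θ), which would tend
  -- to `0` for `θ > 2` because ‖B(n,0)‖ ≥ n.
  have key : ∀ n : ℕ, ‖omegaMatrix p *ᵥ τ‖ * ((n : ℝ) ^ (θ - 2)) ≤ K := fun n => by
    have hY := one_le_matNorm_kz p τ n
    have hY0 : 0 < matNorm (kz p τ n 0) := by linarith
    have h1 := norm_omegaMatrix_zero_le hs hp n τ
    have h2 := norm_iterVec_le_of_gap hgap n hτ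
    have h3 : (n : ℝ) ^ (θ - 2) ≤ matNorm (kz p τ n 0) ^ (θ - 2) :=
      Real.rpow_le_rpow (Nat.cast_nonneg _) (nat_le_matNorm_kz p τ n) (by linarith)
    have h4 : matNorm (kz p τ n 0) * matNorm (kz p τ n 0) ^ (1 - θ) *
        matNorm (kz p τ n 0) ^ (θ - 2) = 1 := by
      nth_rewrite 1 [← Real.rpow_one (matNorm (kz p τ n 0))]
      rw [← Real.rpow_add hY0, ← Real.rpow_add hY0]
      ring_nf
      exact Real.rpow_zero _
    have h5 : ‖omegaMatrix p *ᵥ τ‖ ≤ matNorm (kz p τ n 0) *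
        (Fintype.card A * (C * matNorm (kz p τ n 0) ^ (1 - θ) * ‖τ‖)) :=
      h1.trans (by gcongr)
    calc _ ≤ (matNorm (kz p τ n 0) * (Fintype.card A *
          (C * matNorm (kz p τ n 0) ^ (1 - θ) * ‖τ‖))) * matNorm (kz p τ n 0) ^ (θ - 2) := by
          gcongr
      _ = K * (matNorm (kz p τ n 0) * matNorm (kz p τ n 0) ^ (1 - θ) *
          matNorm (kz p τ n 0) ^ (θ - 2)) := by ring
      _ = K := by rw [h4, mul_one]
  have ht := (tendsto_rpow_atTop (show 0 < θ - 2 by linarith)).comp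
    tendsto_natCast_atTop_atTop
  obtain ⟨n, hn⟩ := (ht.eventually (Filter.eventually_gt_atTop
    (K / ‖omegaMatrix p *ᵥ τ‖))).exists
  simp only [Function.comp_apply] at hn
  rw [div_lt_iff₀' hΩ] at hn
  exact absurd (key n) (not_le.2 hn)

/-- Decomposition of the dual Birkhoff sums at an intermediate time into their mean values and
a part with small values. -/
theorem exists_mean_decomposition (hs : IsSuspension p τ) (hp : HasBackwardPath p τ) {η M : ℝ}
    (hη : 0 ≤ η) (hM : 0 ≤ M) {ψ : A → ℝ → ℝ}
    (hψ : ∀ b, ∀ x ∈ vertInterval p τ 0 b, |ψ b x| ≤ M)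
    (hψ' : ∀ b, ∀ x ∈ vertInterval p τ 0 b, ∀ y ∈ vertInterval p τ 0 b,
      |ψ b x - ψ b y| ≤ M * |x - y| ^ η)
    (hi : ∀ b, IntegrableOn (ψ b) (vertInterval p τ 0 b))
    (h0 : ∑ b, ∫ x in vertInterval p τ 0 b, ψ b x = 0) (m : ℕ) {Q : ℝ}
    (hQ : ∀ b, qAt p τ m b ≤ Q) :
    ∃ u : A → ℝ, ‖u‖ ≤ M * matNorm (kz p τ m 0) ∧ ∑ b, u b * qAt p τ m b = 0 ∧
      ∀ b, ∀ x ∈ vertInterval p τ m b,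
        |iterSum p τ 0 m ψ b x - u b| ≤ M * matNorm (kz p τ m 0) * Q ^ η := by
  obtain ⟨i1, i2⟩ := iterSum_integral hs hp hi m
  have b1 := abs_iterSum_le hs hp hψ m
  have b2 := abs_iterSum_sub_le hs hp (g := fun t => |t| ^ η) (c := fun _ => M) hψ' m
  rw [zero_add] at i1 i2 b1 b2
  set f := iterSum p τ 0 m ψ
  have hc : ∀ b, iterVec p τ 0 m (fun _ => M) b ≤ M * matNorm (kz p τ m 0) := fun b => by
    have h1 := norm_iterVec_le (p := p) (τ := τ) 0 m (fun _ => M)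
    rw [zero_add, pi_norm_const, Real.norm_of_nonneg hM] at h1
    exact (le_abs_self _).trans ((norm_le_pi_norm _ b).trans h1)
  have hX := matNorm_nonneg (kz p τ m 0)
  have hq := qAt_pos hs hp m
  have hvol : ∀ b, volume (vertInterval p τ m b) = ENNReal.ofReal (qAt p τ m b) := fun b => by
    simp [vertInterval]
  have hne : ∀ b, volume (vertInterval p τ m b) ≠ 0 := fun b => by
    rw [hvol]
    simpa using hq b
  have hfin : ∀ b, volume (vertInterval p τ m b) ≠ ∞ := fun b => by
    rw [hvol]
    exact ENNReal.ofReal_ne_top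
  have hmeas : ∀ b, MeasurableSet (vertInterval p τ m b) := fun b => measurableSet_Ioo
  -- The vector `u` consists of the mean values; both bounds follow because the average of a
  -- function with values in a closed interval stays in it.
  refine ⟨fun b => ⨍ x in vertInterval p τ m b, f b x, ?_, ?_, fun b x hx => ?_⟩
  · refine (pi_norm_le_iff_of_nonneg (by positivity)).2 fun b => ?_
    have := (convex_Icc (-(M * matNorm (kz p τ m 0))) (M * matNorm (kz p τ m 0))).set_average_mem
      isClosed_Icc (hne b) (hfin b) (f := f b) ((ae_restrict_iff' (hmeas b)).2
        (Filter.Eventually.of_forall fun x hx => abs_le.1 ((b1 b x hx).trans (hc b)))) (i1 b)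
    exact abs_le.2 this
  · rw [← h0, ← i2]
    refine Finset.sum_congr rfl fun b _ => ?_
    beta_reduce
    rw [setAverage_eq, Measure.real, hvol, ENNReal.toReal_ofReal (hq b).le, smul_eq_mul,
      mul_comm, mul_inv_cancel_left₀ (hq b).ne']
  · set R := M * matNorm (kz p τ m 0) * Q ^ η
    have hR : ∀ y ∈ vertInterval p τ m b, f b y ∈ Icc (f b x - R) (f b x + R) := by
      intro y hy
      have h1 := b2 b x hx y hy
      have h2 : |x - y| ≤ Q := by
        rw [vertInterval, mem_Ioo] at hx hy
        rw [abs_le]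
        constructor <;> linarith [hQ b, hx.1, hx.2, hy.1, hy.2]
      have h3 : |f b x - f b y| ≤ R := h1.trans (mul_le_mul (hc b)
        (Real.rpow_le_rpow (abs_nonneg _) h2 hη) (by positivity) (by positivity))
      rw [abs_le] at h3
      constructor <;> linarith
    have := (convex_Icc (f b x - R) (f b x + R)).set_average_mem
      isClosed_Icc (hne b) (hfin b) (f := f b) ((ae_restrict_iff' (hmeas b)).2
        (Filter.Eventually.of_forall hR)) (i1 b)
    rw [abs_le]
    constructor <;> linarith [this.1, this.2]

/-- The vectors with zero mean value at time `-m` are, up to vectors in the kernel of `Ω`, images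
of vectors with zero mean value at time `0` under control. -/
theorem exists_bounded_lift (hs : IsSuspension p τ) (hp : HasBackwardPath p τ) :
    ∃ K : ℝ, 0 < K ∧ ∀ (m : ℕ) (u : A → ℝ), ∑ b, u b * qAt p τ m b = 0 →
      ∃ v r : A → ℝ, u = iterVec p τ 0 m v + r ∧ ∑ a, v a * qAt p τ 0 a = 0 ∧
        omegaMatrix (piAt p τ m) *ᵥ r = 0 ∧
        ‖v‖ ≤ K * matNorm (kz p τ m 0) * ‖u‖ ∧ ‖r‖ ≤ K * matNorm (kz p τ m 0) ^ 2 * ‖u‖ := by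
  obtain ⟨K, hK, hpre⟩ := exists_bounded_preimage p
  have hd : (1 : ℝ) ≤ Fintype.card A := by exact_mod_cast Fintype.card_pos
  refine ⟨1 + K * Fintype.card A, by positivity, fun m u hu => ?_⟩
  -- The exact preimage `v0` is not under control, but `Ω v0` is. It is replaced by a bounded `v`
  -- with the same image under Ω, and the difference is sent into the kernel of Ω at time `-m`.
  obtain ⟨v0, hv0⟩ := iterVec_surjective hs hp 0 m u
  obtain ⟨v, hv, hvK⟩ := hpre v0
  have hX := one_le_matNorm_kz p τ m
  have hX0 : 0 < matNorm (kz p τ m 0) := by linarith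
  have hker : omegaMatrix p *ᵥ (v0 - v) = 0 := by rw [mulVec_sub, hv, sub_self]
  have hnv : ‖v‖ ≤ K * Fintype.card A * matNorm (kz p τ m 0) * ‖u‖ := by
    have h1 := norm_omegaMatrix_zero_le hs hp m v0
    rw [hv0] at h1
    calc ‖v‖ ≤ K * ‖omegaMatrix p *ᵥ v0‖ := hvK
      _ ≤ K * (matNorm (kz p τ m 0) * (Fintype.card A * ‖u‖)) := by gcongr
      _ = _ := by ring
  refine ⟨v, iterVec p τ 0 m (v0 - v), ?_, ?_, omegaMatrix_iterVec_eq_zero hs hp m hker, ?_, ?_⟩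
  · rw [iterVec_sub, hv0]
    simp
  · have h1 := sum_mul_qAt hs hp m v0
    rw [hv0, hu] at h1
    -- The kernel of Ω is orthogonal to its range, which contains `q`.
    have h2 : ∑ a, (v0 - v) a * qAt p τ 0 a = 0 := by
      have := sum_mul_omegaMatrix_mulVec p (v0 - v) τ
      rw [hker] at this
      have hq : ∀ a, qAt p τ 0 a = -(omegaMatrix p *ᵥ τ) a := fun a => rfl
      simp only [hq, mul_neg, Finset.sum_neg_distrib, this]
      simp
    simp only [Pi.sub_apply, sub_mul, Finset.sum_sub_distrib] at h2
    linarith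
  · refine hnv.trans ?_
    gcongr
    linarith
  · rw [iterVec_sub, hv0]
    have h1 := norm_iterVec_le (p := p) (τ := τ) 0 m v
    rw [zero_add] at h1
    have h2 : ‖u‖ ≤ matNorm (kz p τ m 0) ^ 2 * ‖u‖ :=
      le_mul_of_one_le_left (norm_nonneg _) (one_le_pow₀ hX)
    calc _ ≤ ‖u‖ + ‖iterVec p τ 0 m v‖ := norm_sub_le _ _
      _ ≤ matNorm (kz p τ m 0) ^ 2 * ‖u‖ +
          K * Fintype.card A * matNorm (kz p τ m 0) * ‖u‖ * matNorm (kz p τ m 0) :=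
        add_le_add h2 (h1.trans (by gcongr))
      _ = _ := by ring

theorem abs_iterSum_le_of_decomposition (hs : IsSuspension p τ) (hp : HasBackwardPath p τ)
    {m k : ℕ} {ψ : A → ℝ → ℝ} {u : A → ℝ} {R : ℝ} (hR : 0 ≤ R)
    (h : ∀ b, ∀ x ∈ vertInterval p τ m b, |iterSum p τ 0 m ψ b x - u b| ≤ R) {b : A} {x : ℝ}
    (hx : x ∈ vertInterval p τ (m + k) b) :
    |iterSum p τ 0 (m + k) ψ b x|
      ≤ ‖iterVec p τ m k u‖ + R * matNorm (kz p τ (m + k) m) := by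
  have h1 := abs_iterSum_le hs hp (ψ := fun b x => iterSum p τ 0 m ψ b x - u b)
    (c := fun _ => R) h k b x hx
  have h2 : iterSum p τ 0 m ψ
      = (fun b _ => u b) + fun b x => iterSum p τ 0 m ψ b x - u b := by
    ext b x
    simp
  have h3 := norm_iterVec_le (p := p) (τ := τ) m k (fun _ => R)
  rw [pi_norm_const, Real.norm_of_nonneg hR] at h3
  rw [iterSum_add, zero_add, h2, iterSum_add_fun, iterSum_const]
  refine (abs_add_le _ _).trans (add_le_add (norm_le_pi_norm (iterVec p τ m k u) b) (h1.trans ?_))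
  exact (le_abs_self _).trans ((norm_le_pi_norm _ b).trans h3)

end Estimates

/-! ### The choice of exponents, and the passage to Hölder norms -/

section Main

variable {A : Type*} [Fintype A] [DecidableEq A] [Nontrivial A] {p : CombData A} {τ : A → ℝ}

theorem exists_bound_iterSum (hRoth : IsDualRothType p τ) {θ : ℝ} (hθ : DualSpectralGap p τ θ)
    {η : ℝ} (hη0 : 0 < η) (hη1 : η < 1) :
    ∃ C : ℝ, 0 < C ∧ ∀ (M : ℝ) (ψ : A → ℝ → ℝ), 0 ≤ M →
      (∀ b, ∀ x ∈ vertInterval p τ 0 b, |ψ b x| ≤ M) →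
      (∀ b, ∀ x ∈ vertInterval p τ 0 b, ∀ y ∈ vertInterval p τ 0 b,
        |ψ b x - ψ b y| ≤ M * |x - y| ^ η) →
      (∀ b, IntegrableOn (ψ b) (vertInterval p τ 0 b)) →
      ∑ b, ∫ x in vertInterval p τ 0 b, ψ b x = 0 →
      ∀ n b, ∀ x ∈ vertInterval p τ n b, |iterSum p τ 0 n ψ b x|
        ≤ C * M * matNorm (kz p τ n 0) ^ (1 - θ * η / 20) := by
  have hs := hRoth.suspension
  have hp := hRoth.hasPath
  have hc := hRoth.complete
  have hg := hRoth.growth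
  have hθ2 := hθ.le_two hs hp
  obtain ⟨hθ0, C₁, hC₁, hgap⟩ := hθ
  -- The loss `η / 8` leaves the oscillating part with the power 1 - (1 + η)(1 - η/8) ≤ -3η/4 of X.
  obtain ⟨Cq, hCq, hq⟩ := qAt_accTime_le hs hp hc hg (ε := η / 8) (by linarith) (by linarith)
  obtain ⟨Cb, hCb, hb⟩ := matNorm_kz_accTime_le hc hg (ε := η / 8) (by linarith) (by linarith)
  -- With exponent `1 / 2`, the next norm is at most `Cg * X ^ (3/2)`, and X^(-3η/4) is exactly
  -- (X^(3/2))^(-η/2).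
  obtain ⟨Cg, hCg, hgr⟩ := accNorm_succ_le hc hg (ε := 1 / 2) (by norm_num)
  obtain ⟨K, hK, hlift⟩ := exists_bounded_lift hs hp
  set X₀ := accNorm p τ 0
  have hX₀ : 1 ≤ X₀ := one_le_accNorm p τ 0
  set d : ℝ := ((Fintype.card A : ℕ) : ℝ)
  have hd : 0 ≤ d := Nat.cast_nonneg _
  have hCg0 : 0 < Cg := by linarith
  refine ⟨C₁ * (K * X₀ ^ 2) + 2 * ((d + 1) * (K * X₀ ^ 3)) + Cq ^ η * Cb * Cg ^ (η / 2),
    by positivity, fun M ψ hM hψ hψ' hi h0 n b x hx => ?_⟩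
  -- The power `θ / 10` is small enough for X²Y^(1-θ) and X³ to be admissible, and with the saving
  -- (Y^(θ/10))^(-η/2) it gives the exponent `θ * η / 20`.
  obtain ⟨k, hkn, hk1, hk2⟩ := exists_accTime_between hc (s := θ / 10) (by linarith)
    (by linarith) n
  obtain ⟨j, rfl⟩ := Nat.exists_eq_add_of_le hkn
  set m := accTime p τ k
  set Y := matNorm (kz p τ (m + j) 0)
  have hY : 1 ≤ Y := one_le_matNorm_kz p τ _
  have hY0 : 0 < Y := by linarith
  have hXeq : accNorm p τ k = matNorm (kz p τ m 0) := rfl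
  have hX := one_le_accNorm p τ k
  set X := accNorm p τ k
  have hX0 : 0 < X := by linarith
  obtain ⟨u, hu1, hu2, hu3⟩ := exists_mean_decomposition hs hp hη0.le hM hψ hψ' hi h0 m (hq k)
  obtain ⟨v, r, huv, hv1, hr1, hv2, hr2⟩ := hlift m u hu2
  rw [← hXeq] at hu1 hu3 hv2 hr2
  have hmain := abs_iterSum_le_of_decomposition hs hp (k := j) (by positivity) hu3 hx
  set E := Y ^ (1 - θ * η / 20)
  have hθη : θ * η ≤ θ := mul_le_of_le_one_right hθ0.le hη1.le
  -- the part of the mean values which comes from time `0`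
  have t1 : ‖iterVec p τ 0 (m + j) v‖ ≤ C₁ * (K * X₀ ^ 2) * M * E := by
    have e : Y ^ (1 - θ) * (Y ^ (θ / 10)) ^ 2 ≤ E := by
      rw [← Real.rpow_natCast, ← Real.rpow_mul hY0.le, ← Real.rpow_add hY0]
      refine Real.rpow_le_rpow_of_exponent_le hY ?_
      push_cast
      linarith
    calc ‖iterVec p τ 0 (m + j) v‖ ≤ C₁ * Y ^ (1 - θ) * ‖v‖ :=
          norm_iterVec_le_of_gap hgap (m + j) hv1
      _ ≤ C₁ * Y ^ (1 - θ) * (K * X * (M * X)) := by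
          gcongr
          exact hv2.trans (by gcongr)
      _ = C₁ * Y ^ (1 - θ) * K * M * X ^ 2 := by ring
      _ ≤ C₁ * Y ^ (1 - θ) * K * M * (X₀ * Y ^ (θ / 10)) ^ 2 := by gcongr
      _ = C₁ * (K * X₀ ^ 2) * M * (Y ^ (1 - θ) * (Y ^ (θ / 10)) ^ 2) := by ring
      _ ≤ _ := by gcongr
  -- the part of the mean values in the kernel
  have t2 : ‖iterVec p τ m j r‖ ≤ 2 * ((d + 1) * (K * X₀ ^ 3)) * M * E := by
    -- Here `θ ≤ 2` enters: 3θ/10 + θη/20 ≤ 7θ/20 < 1.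
    have e : (Y ^ (θ / 10)) ^ 3 ≤ E := by
      rw [← Real.rpow_natCast, ← Real.rpow_mul hY0.le]
      refine Real.rpow_le_rpow_of_exponent_le hY ?_
      push_cast
      linarith
    calc ‖iterVec p τ m j r‖ ≤ 2 * ((d + 1) * ‖r‖) := norm_iterVec_kernel_le hs hp m j hr1
      _ ≤ 2 * ((d + 1) * (K * X ^ 2 * (M * X))) := by
          gcongr
          exact hr2.trans (by gcongr)
      _ = 2 * ((d + 1) * K) * M * X ^ 3 := by ring
      _ ≤ 2 * ((d + 1) * K) * M * (X₀ * Y ^ (θ / 10)) ^ 3 := by gcongr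
      _ = 2 * ((d + 1) * (K * X₀ ^ 3)) * M * (Y ^ (θ / 10)) ^ 3 := by ring
      _ ≤ _ := by gcongr
  -- the oscillating part
  have t3 : M * X * (Cq * X ^ (-(1 - η / 8))) ^ η * matNorm (kz p τ (m + j) m)
      ≤ Cq ^ η * Cb * Cg ^ (η / 2) * M * E := by
    have e1 : X * (X ^ (-(1 - η / 8))) ^ η * X ^ (-(1 - η / 8))
        ≤ (X ^ (3 / 2 : ℝ)) ^ (-(η / 2)) := by
      rw [← Real.rpow_mul hX0.le, ← Real.rpow_mul hX0.le]
      nth_rewrite 1 [← Real.rpow_one X]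
      rw [← Real.rpow_add hX0, ← Real.rpow_add hX0]
      refine Real.rpow_le_rpow_of_exponent_le hX ?_
      nlinarith
    have e2 : Y ^ (θ / 10) / Cg ≤ X ^ (3 / 2 : ℝ) := by
      rw [div_le_iff₀' hCg0]
      refine hk2.trans ((hgr k).trans_eq ?_)
      rw [show (3 / 2 : ℝ) = 1 + 1 / 2 by norm_num, Real.rpow_add hX0, Real.rpow_one]
      ring
    have e3 : (X ^ (3 / 2 : ℝ)) ^ (-(η / 2)) ≤ (Y ^ (θ / 10) / Cg) ^ (-(η / 2)) :=
      Real.rpow_le_rpow_of_nonpos (by positivity) e2 (by linarith)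
    have e4 : (Y ^ (θ / 10) / Cg) ^ (-(η / 2)) = Cg ^ (η / 2) * Y ^ (-(θ * η / 20)) := by
      rw [Real.div_rpow (by positivity) hCg0.le, Real.rpow_neg hCg0.le, div_inv_eq_mul,
        ← Real.rpow_mul hY0.le, mul_comm]
      ring_nf
    have e5 : Y * Y ^ (-(θ * η / 20)) = E := by
      nth_rewrite 1 [← Real.rpow_one Y]
      rw [← Real.rpow_add hY0, ← sub_eq_add_neg]
    calc _ ≤ M * X * (Cq * X ^ (-(1 - η / 8))) ^ η * (Cb * Y * X ^ (-(1 - η / 8))) := by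
          gcongr
          exact hb k (m + j) hkn
      _ = Cq ^ η * Cb * M * Y * (X * (X ^ (-(1 - η / 8))) ^ η * X ^ (-(1 - η / 8))) := by
          rw [Real.mul_rpow hCq.le (by positivity)]
          ring
      _ ≤ Cq ^ η * Cb * M * Y * (Cg ^ (η / 2) * Y ^ (-(θ * η / 20))) := by
          rw [← e4]
          gcongr
          exact e1.trans e3
      _ = Cq ^ η * Cb * Cg ^ (η / 2) * M * (Y * Y ^ (-(θ * η / 20))) := by ring
      _ = _ := by rw [e5]
  -- Applying ᵗB(n,m) to u = ᵗB(m,0)v + r gives ᵗB(n,0)v + ᵗB(n,m)r by the cocycle relation.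
  have hsplit : ‖iterVec p τ m j u‖ ≤ ‖iterVec p τ 0 (m + j) v‖ + ‖iterVec p τ m j r‖ := by
    have h1 : iterVec p τ m j r = iterVec p τ m j u - iterVec p τ 0 (m + j) v := by
      rw [iterVec_add, zero_add, ← iterVec_sub, huv]
      simp
    have h2 : iterVec p τ m j u = iterVec p τ 0 (m + j) v + iterVec p τ m j r := by
      rw [h1]
      simp
    rw [h2]
    exact norm_add_le _ _
  calc _ ≤ _ := hmain
    _ ≤ _ := add_le_add (hsplit.trans (add_le_add t1 t2)) t3
    _ = _ := by ring

theorem abs_le_of_normHolder {n : ℕ} {η : ℝ≥0} {ψ : A → ℝ → ℝ}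
    (h : normHolder p τ n η ψ ≠ ⊤) {b : A} {x : ℝ} (hx : x ∈ vertInterval p τ n b) :
    |ψ b x| ≤ (normHolder p τ n η ψ).toReal := by
  have h1 : ‖ψ b x‖ₑ ≤ normHolder p τ n η ψ := by
    refine le_trans ?_ le_self_add
    exact le_iSup_of_le b (le_iSup₂_of_le x hx le_rfl)
  have := ENNReal.toReal_mono h h1
  simpa using this

theorem abs_sub_le_of_normHolder {n : ℕ} {η : ℝ≥0} {ψ : A → ℝ → ℝ} (hψ : IsHolder p τ n η ψ)
    (h : normHolder p τ n η ψ ≠ ⊤) {b : A} {x y : ℝ} (hx : x ∈ vertInterval p τ n b)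
    (hy : y ∈ vertInterval p τ n b) :
    |ψ b x - ψ b y| ≤ (normHolder p τ n η ψ).toReal * |x - y| ^ (η : ℝ) := by
  have h1 := (hψ b).holderWith.dist_le ⟨x, hx⟩ ⟨y, hy⟩
  have h2 : (nnHolderNorm η ((vertInterval p τ n b).domRestrict (ψ b)) : ℝ≥0∞)
      ≤ normHolder p τ n η ψ := by
    rw [(hψ b).coe_nnHolderNorm_eq_eHolderNorm]
    exact (le_iSup (fun a => eHolderNorm η ((vertInterval p τ n a).domRestrict (ψ a))) b).trans
      le_add_self
  have h3 := ENNReal.toReal_mono h h2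
  rw [ENNReal.coe_toReal] at h3
  refine le_trans h1 (mul_le_mul_of_nonneg_right h3 (by positivity))

theorem IsHolder.integrableOn {η : ℝ≥0} (hη : 0 < η) {n : ℕ} {ψ : A → ℝ → ℝ}
    (hψ : IsHolder p τ n η ψ) (h : normHolder p τ n η ψ ≠ ⊤) (b : A) :
    IntegrableOn (ψ b) (vertInterval p τ n b) := by
  have hcont : ContinuousOn (ψ b) (vertInterval p τ n b) :=
    continuousOn_iff_continuous_domRestrict.2 ((hψ b).holderWith.continuous hη)
  refine IntegrableOn.of_bound (by simp [vertInterval])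
    (hcont.aestronglyMeasurable measurableSet_Ioo) (normHolder p τ n η ψ).toReal ?_
  exact (ae_restrict_iff' measurableSet_Ioo).2
    (Filter.Eventually.of_forall fun x hx => abs_le_of_normHolder h hx)

end Main

end

end DualRoth

theorem proposition4p5 {A : Type*} [Fintype A] [DecidableEq A] [Nontrivial A]
    (p : DualRoth.CombData A) (τ : A → ℝ) (hRoth : DualRoth.IsDualRothType p τ)
    (θ : ℝ) (hθ : DualRoth.DualSpectralGap p τ θ)
    (η : NNReal) (hη0 : 0 < η) (hη1 : η < 1) :
    ∃ C : ℝ, 0 < C ∧ ∀ l : A → ℝ, (∀ a, 0 < l a) → ∀ ψ : A → ℝ → ℝ,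
      DualRoth.MeanZero p τ 0 ψ → DualRoth.IsHolder p τ 0 η ψ → ∀ n : ℕ,
        DualRoth.normC0 p τ n (DualRoth.dualBirkhoff p τ l 0 n ψ) ≤
          ENNReal.ofReal C * DualRoth.normHolder p τ 0 η ψ *
            ENNReal.ofReal
              (DualRoth.matNorm (DualRoth.kz p τ n 0) ^ (1 - θ * (η : ℝ) / 20)) := by
  obtain ⟨C, hC, hbound⟩ := DualRoth.exists_bound_iterSum hRoth hθ (η := η)
    (by exact_mod_cast hη0) (by exact_mod_cast hη1)
  refine ⟨C, hC, fun l hl ψ hmean hψ n => ?_⟩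
  have hY : 0 < DualRoth.matNorm (DualRoth.kz p τ n 0) :=
    lt_of_lt_of_le one_pos (DualRoth.one_le_matNorm_kz p τ n)
  have hE : 0 < DualRoth.matNorm (DualRoth.kz p τ n 0) ^ (1 - θ * (η : ℝ) / 20) :=
    Real.rpow_pos_of_pos hY _
  -- An infinite norm makes the right-hand side infinite, since the other two factors are positive;
  -- otherwise all estimates are made in the reals.
  by_cases htop : DualRoth.normHolder p τ 0 η ψ = ⊤
  · rw [htop, ENNReal.mul_top (by simpa using hC), ENNReal.top_mul (by simpa using hE)]
    exact le_top
  rw [DualRoth.dualBirkhoff_eq_iterSum hRoth.suspension hRoth.hasPath hl]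
  refine iSup_le fun b => iSup₂_le fun x hx => ?_
  have h := hbound (DualRoth.normHolder p τ 0 η ψ).toReal ψ ENNReal.toReal_nonneg
    (fun b x hx => DualRoth.abs_le_of_normHolder htop hx)
    (fun b x hx y hy => DualRoth.abs_sub_le_of_normHolder hψ htop hx hy)
    (hψ.integrableOn hη0 htop) hmean n b x hx
  rw [Real.enorm_eq_ofReal_abs]
  refine (ENNReal.ofReal_le_ofReal h).trans_eq ?_
  rw [ENNReal.ofReal_mul (by positivity), ENNReal.ofReal_mul hC.le, ENNReal.ofReal_toReal htop]
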